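/- **Definitions.** A basic sequence is a sequence of integers $Q=(q_n)_{n\ge 1}$ with $q_n\ge 2$; it is infinite in limit if $q_n\to\infty$. Every real $x$ has a unique $Q$-Cantor series expansion $x=E_0+\sum_{n\ge1}\frac{E_n}{q_1\cdots q_n}$ with $E_0=\lfloor x\rfloor$, $E_n\in\{0,\dots,q_n-1\}$ for $n\ge 1$, and $E_n\ne q_n-1$ infinitely often. For a block $B=[B_1,\dots,B_k]$ ($k\ge1$) of non-negative integers let $$N_n^Q(B,x)=\#\{1\le i\le n: E_{i+j-1}=B_j,\ 1\le j\le k\},\qquad Q_n(B)=\sum_{i=1}^n\frac{I_i(B)}{q_iq_{i+1}\cdots q_{i+k-1}},$$ where $I_i(B)=1$ if $B_j<q_{i+j-1}$ for all $1\le j\le k$ and $I_i(B)=0$ otherwise. * $x$ is $Q$-normal, $x\in\mathcal N(Q)$, if $N_n^Q(B,x)/Q_n(B)\to1$ for every block $B$ with $Q_n(B)\to\infty$. * $x$ is $Q$-ratio normal, $x\in\mathcal{RN}(Q)$, if $N_n^Q(B_1,x)/N_n^Q(B_2,x)\to1$ for all blocks $B_1,B_2$ of equal length with $Q_n(B_1)\to\infty$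 and $Q_n(B_2)\to\infty$. * $x$ is $Q$-distribution normal, $x\in\mathcal{DN}(Q)$, if the sequence $(q_nq_{n-1}\cdots q_1x)_{n\ge0}$ is uniformly distributed modulo $1$. A real number is computable if, for some integer base $b\ge2$, its base-$b$ digits are given by a total recursive function; a sequence of integers is computable if it is given by a total recursive function. Let $P=(p_i)$ with $p_i=\lfloor\log i\rfloor+2$, let $P_m(B)$ be defined from $P$ as $Q_m(B)$ is from $Q$, and put $P_m(B)=0$ for $m\le0$. Define $L_0=0$ and, for $n\ge1$, $$L_n=\max\Bigl\{\min\{t\ge 1:\log q_j>n\ \ \forall j\ge t\},\ L_{n-1}+n^2,\ L_{n-1}+\nu_n,\ \max_{1\le k\le n}\upsilon_{n,k}\Bigr\},$$ $$\nu_n=\min\Bigl\{t:\frac{\sum_{i=0}^{n-1}\log q_{L_{n-1}+i}}{\sum_{i=0}^{j-L_{n-1}-1}\log q_{L_{n-1}+i}}<\frac1n\ \ \forall j\ge t\Bigr\},$$ $$\upsilon_{n,k}=\min\Bigl\{t:\frac{Q_n(B)}{\sum_{i=1}^jP_{i-k+1}(B)}<\frac1n\ \ \forall j\ge t\text{ and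 all blocks }B\text{ of length }k\Bigr\}.$$ (The undefined term $\log q_0$, which could occur only for $n=1$, is omitted; in $\upsilon_{n,k}$ the quotient is read as $0$ when $Q_n(B)=0$; any other quotient with zero denominator is regarded as not being less than $1/n$.) **Theorem.** Let $Q$ be a basic sequence that is infinite in limit and such that $Q_n(B)\to\infty$ for at least one block $B$ (for $Q$ infinite in limit this means $\sum_n 1/q_n=\infty$). Suppose that the sequences $(q_n)$ and $(L_n)$ are computable. Then there is a computable real number $x\in\mathcal{RN}(Q)\cap\mathcal{DN}(Q)\setminus\mathcal N(Q)$. -/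

import Mathlib

/-! Basic sequences are functions `q : ℕ → ℕ` of which only the values `q n` with `1 ≤ n` matter;
`q 0` is never used.  A block of length `k` is a function `B : Fin k → ℕ`, whose entries
`B_1, …, B_k` are `B 0, …, B (k - 1)`. -/

namespace CantorSeries

open Filter Topology

/-- A basic sequence: integers greater than or equal to `2`. -/
def IsBasic (q : ℕ → ℕ) : Prop := ∀ n, 1 ≤ n → 2 ≤ q n

/-- `T_{Q,n}(x) = q_n q_{n-1} ⋯ q_1 x (mod 1)`. -/
noncomputable def T (q : ℕ → ℕ) (n : ℕ) (x : ℝ) : ℝ :=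
  Int.fract ((∏ i ∈ Finset.Icc 1 n, (q i : ℝ)) * x)

/-- The `n`-th digit (`1 ≤ n`) of the `Q`-Cantor series expansion of `x`, that is
`E_n = ⌊q_n T_{Q,n-1}(x)⌋`; see `digit_expansion` below. -/
noncomputable def digit (q : ℕ → ℕ) (x : ℝ) (n : ℕ) : ℕ :=
  ⌊(q n : ℝ) * T q (n - 1) x⌋₊

theorem T_succ {q : ℕ → ℕ} (x : ℝ) (n : ℕ) :
    T q (n + 1) x = (q (n + 1) : ℝ) * T q n x - digit q x (n + 1) := by
  have h0 : 0 ≤ (q (n + 1) : ℝ) * T q n x :=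
    mul_nonneg (Nat.cast_nonneg _) (Int.fract_nonneg _)
  have h1 : T q (n + 1) x = Int.fract ((q (n + 1) : ℝ) * T q n x) := by
    unfold T
    rw [Finset.prod_Icc_succ_top (by omega), Int.fract_eq_fract]
    refine ⟨(q (n + 1) : ℤ) * ⌊(∏ i ∈ Finset.Icc 1 n, (q i : ℝ)) * x⌋, ?_⟩
    rw [← Int.self_sub_floor]
    push_cast
    ring
  have h2 : ((digit q x (n + 1) : ℕ) : ℝ) = (⌊(q (n + 1) : ℝ) * T q n x⌋ : ℤ) := by
    simp only [digit, Nat.add_sub_cancel]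
    exact natCast_floor_eq_intCast_floor h0
  rw [h1, h2, Int.self_sub_floor]

/-- The digits `E_n` are the `Q`-Cantor series digits of `x`: for `n ≥ 1` one has
`E_n ∈ {0, …, q_n - 1}`, `E_n ≠ q_n - 1` infinitely often, and
`x = ⌊x⌋ + ∑_{n ≥ 1} E_n / (q_1 ⋯ q_n)`. -/
theorem digit_expansion {q : ℕ → ℕ} (hq : IsBasic q) (x : ℝ) :
    (∀ n, 1 ≤ n → digit q x n < q n) ∧
    (∀ m, ∃ n, m ≤ n ∧ 1 ≤ n ∧ digit q x n ≠ q n - 1) ∧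
    HasSum (fun n : ℕ => (digit q x (n + 1) : ℝ) / ∏ i ∈ Finset.Icc 1 (n + 1), (q i : ℝ))
      (x - ⌊x⌋) := by
  have T0 : ∀ n, 0 ≤ T q n x := fun n => Int.fract_nonneg _
  have T1 : ∀ n, T q n x < 1 := fun n => Int.fract_lt_one _
  have hq2 : ∀ n, (2 : ℝ) ≤ q (n + 1) := fun n => by exact_mod_cast hq (n + 1) (by omega)
  have hprod : ∀ n, (2 : ℝ) ^ n ≤ ∏ i ∈ Finset.Icc 1 n, (q i : ℝ) := by
    intro n
    induction n with
    | zero => simp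
    | succ n ih =>
      rw [Finset.prod_Icc_succ_top (by omega), pow_succ]
      exact mul_le_mul ih (hq2 n) (by norm_num) (le_trans (by positivity) ih)
  have hpos : ∀ n, (0 : ℝ) < ∏ i ∈ Finset.Icc 1 n, (q i : ℝ) := fun n =>
    lt_of_lt_of_le (by positivity) (hprod n)
  refine ⟨?_, ?_, ?_⟩
  · intro n hn
    have hqn : (0 : ℝ) < q n := by exact_mod_cast (by have := hq n hn; omega : 0 < q n)
    refine (Nat.floor_lt (mul_nonneg hqn.le (T0 _))).2 ?_
    nlinarith [T1 (n - 1)]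
  · intro m
    by_contra! h
    have key : ∀ j, (2 : ℝ) ^ j * (1 - T q m x) ≤ 1 - T q (m + j) x := by
      intro j
      induction j with
      | zero => simp
      | succ j ih =>
        have hd := h (m + j + 1) (by omega) (by omega)
        have hle : 1 ≤ q (m + j + 1) := by have := hq (m + j + 1) (by omega); omega
        have hT := T_succ (q := q) x (m + j)
        rw [hd, Nat.cast_sub hle] at hT
        rw [← add_assoc, hT, pow_succ]
        push_cast
        nlinarith [hq2 (m + j), T1 (m + j)]
    obtain ⟨j, hj⟩ := pow_unbounded_of_one_lt (1 / (1 - T q m x)) (one_lt_two : (1 : ℝ) < 2)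
    have hm : 0 < 1 - T q m x := by linarith [T1 m]
    rw [div_lt_iff₀ hm] at hj
    linarith [key j, T0 (m + j)]
  · have hsum : ∀ n, ∑ i ∈ Finset.range n,
        (digit q x (i + 1) : ℝ) / ∏ l ∈ Finset.Icc 1 (i + 1), (q l : ℝ)
        = (x - ⌊x⌋) - T q n x / ∏ l ∈ Finset.Icc 1 n, (q l : ℝ) := by
      intro n
      induction n with
      | zero => simp [T, Int.self_sub_floor]
      | succ n ih =>
        rw [Finset.sum_range_succ, ih, T_succ x n, Finset.prod_Icc_succ_top (by omega)]
        have h1 := (hpos n).ne'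
        have h2 : (q (n + 1) : ℝ) ≠ 0 := by linarith [hq2 n]
        field_simp
        ring
    rw [hasSum_iff_tendsto_nat_of_nonneg
      (fun n => div_nonneg (Nat.cast_nonneg _) (hpos (n + 1)).le)]
    simp_rw [hsum]
    have hz : Tendsto (fun n => T q n x / ∏ l ∈ Finset.Icc 1 n, (q l : ℝ)) atTop (𝓝 0) := by
      refine squeeze_zero (fun n => div_nonneg (T0 n) (hpos n).le) (fun n => ?_)
        (tendsto_pow_atTop_nhds_zero_of_lt_one (by norm_num : (0 : ℝ) ≤ 1 / 2) (by norm_num))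
      rw [one_div, inv_pow, ← one_div]
      exact div_le_div₀ zero_le_one (T1 n).le (by positivity) (hprod n)
    simpa using tendsto_const_nhds.sub hz

/-- `N_n^Q(B, x)`: the number of `1 ≤ i ≤ n` with `E_{i+j-1} = B_j` for `1 ≤ j ≤ k`. -/
noncomputable def blockCount (q : ℕ → ℕ) {k : ℕ} (B : Fin k → ℕ) (x : ℝ) (n : ℕ) : ℕ :=
  ((Finset.Icc 1 n).filter (fun i => ∀ j : Fin k, digit q x (i + j) = B j)).card

/-- `Q_n(B) = ∑_{i=1}^n I_i(B) / (q_i q_{i+1} ⋯ q_{i+k-1})`, where `I_i(B)` is `1` if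
`B_j < q_{i+j-1}` for `1 ≤ j ≤ k` and `0` otherwise. -/
noncomputable def expectedCount (q : ℕ → ℕ) {k : ℕ} (B : Fin k → ℕ) (n : ℕ) : ℝ :=
  ∑ i ∈ Finset.Icc 1 n,
    (if ∀ j : Fin k, B j < q (i + j) then (1 : ℝ) else 0) / ∏ j : Fin k, (q (i + j) : ℝ)

/-- `lim_{n → ∞} Q_n(B) = ∞`. -/
def BlockDivergent (q : ℕ → ℕ) {k : ℕ} (B : Fin k → ℕ) : Prop :=
  Tendsto (expectedCount q B) atTop atTop

/-- `x` is `Q`-normal. -/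
def IsNormal (q : ℕ → ℕ) (x : ℝ) : Prop :=
  ∀ (k : ℕ), 1 ≤ k → ∀ B : Fin k → ℕ, BlockDivergent q B →
    Tendsto (fun n => (blockCount q B x n : ℝ) / expectedCount q B n) atTop (𝓝 1)

/-- `x` is `Q`-ratio normal. -/
def IsRatioNormal (q : ℕ → ℕ) (x : ℝ) : Prop :=
  ∀ (k : ℕ), 1 ≤ k → ∀ B₁ B₂ : Fin k → ℕ, BlockDivergent q B₁ → BlockDivergent q B₂ →
    Tendsto (fun n => (blockCount q B₁ x n : ℝ) / (blockCount q B₂ x n : ℝ)) atTop (𝓝 1)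

/-- The sequence `(u_n)_{n ≥ 0}` of real numbers is uniformly distributed modulo `1`. -/
def UniformlyDistributedMod1 (u : ℕ → ℝ) : Prop :=
  ∀ a b : ℝ, 0 ≤ a → a ≤ b → b ≤ 1 →
    Tendsto (fun N : ℕ =>
      (((Finset.range N).filter (fun n => a ≤ Int.fract (u n) ∧ Int.fract (u n) < b)).card : ℝ)
        / (N : ℝ)) atTop (𝓝 (b - a))

/-- `x` is `Q`-distribution normal. -/
def IsDistributionNormal (q : ℕ → ℕ) (x : ℝ) : Prop :=
  UniformlyDistributedMod1 (fun n => T q n x)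

/-- A real number is computable if, in some base `b ≥ 2`, its digits are calculated by a total
recursive function. -/
def IsComputableReal (x : ℝ) : Prop :=
  ∃ b : ℕ, 2 ≤ b ∧ ∃ f : ℕ → ℕ, Computable f ∧ ∀ n, 1 ≤ n → f n = digit (fun _ => b) x n

/-- The basic sequence `p_i = ⌊log i⌋ + 2`. -/
noncomputable def P (i : ℕ) : ℕ := ⌊Real.log (i : ℝ)⌋₊ + 2

/-- `min {t : log q_j > n for all j ≥ t}`. -/
noncomputable def logThreshold (q : ℕ → ℕ) (n : ℕ) : ℕ :=
  sInf {t : ℕ | 1 ≤ t ∧ ∀ j, t ≤ j → (n : ℝ) < Real.log (q j)}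

/-- `ν_n`, as a function of `n` and of `l = L_{n-1}`: the least `t` such that for all `j ≥ t`
`(∑_{i=0}^{n-1} log q_{l+i}) / (∑_{i=0}^{j-l-1} log q_{l+i}) < 1/n`.
The sums are written over `m = l + i`; the undefined term `log q_0` (which would occur only for
`l = 0`, that is `n = 1`) is left out, and a quotient with zero denominator is not `< 1/n`. -/
noncomputable def nu (q : ℕ → ℕ) (n l : ℕ) : ℕ :=
  sInf {t : ℕ | ∀ j, t ≤ j →
    0 < ∑ m ∈ Finset.Ico (max l 1) j, Real.log (q m) ∧
    (∑ m ∈ Finset.Ico (max l 1) (l + n), Real.log (q m)) /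
      (∑ m ∈ Finset.Ico (max l 1) j, Real.log (q m)) < 1 / (n : ℝ)}

/-- `υ_{n,k}`: the least `t` such that `Q_n(B) / ∑_{i=1}^j P_{i-k+1}(B) < 1/n` for all `j ≥ t` and
all blocks `B` of length `k`.  Here `P_m(B) = 0` for `m ≤ 0`; the quotient counts as `0` if
`Q_n(B) = 0`, and as infinite if only its denominator vanishes. -/
noncomputable def upsilon (q : ℕ → ℕ) (n k : ℕ) : ℕ :=
  sInf {t : ℕ | ∀ j, t ≤ j → ∀ B : Fin k → ℕ,
    expectedCount q B n = 0 ∨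
    (0 < ∑ i ∈ Finset.Icc 1 j, expectedCount P B (i + 1 - k) ∧
      expectedCount q B n / (∑ i ∈ Finset.Icc 1 j, expectedCount P B (i + 1 - k))
        < 1 / (n : ℝ))}

/-- The auxiliary sequence `(L_n)`: `L_0 = 0` and, for `n ≥ 1`,
`L_n = max {min {t : log q_j > n for all j ≥ t}, L_{n-1} + n², L_{n-1} + ν_n,
max_{1 ≤ k ≤ n} υ_{n,k}}`. -/
noncomputable def L (q : ℕ → ℕ) : ℕ → ℕ
  | 0 => 0
  | n + 1 => max (max (logThreshold q (n + 1)) (L q n + (n + 1) ^ 2))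
      (max (L q n + nu q (n + 1) (L q n))
        ((Finset.Icc 1 (n + 1)).sup (fun k => upsilon q (n + 1) k)))

end CantorSeries

/-! The digits of `x` are written down explicitly (`goodDigit`) as a mixture of two kinds. The
background consists of spread digits: the digit at `n` is about `q n` times a uniformly distributed
sequence (`squareFrac`), but at least the integer square root of `q n`. Into it chunks are inserted;
a chunk of level `b` lists all words of length `b` over an alphabet of `b` letters, with one spread
digit after each word as separator.

Since spread digits tend to infinity, a fixed block eventually occurs only inside single words of
chunks (`occurrence_iff`). A permutation of letters shows that a chunk contains two blocks of the
same length equally often (`card_chunkMatch_eq`). The cost of a level makes the length of the `r`-th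
chunk `o(r)`, while each late chunk contains every given block at least once, so an unfinished chunk
does not matter in the limit (`tendsto_count_div_count`): this gives ratio normality.

A chunk is started only if the total length of all chunks so far stays below half of `∑ 1 / q i`. Up
to a constant, the digit 0 therefore occurs at most half as often as normality requires
(`not_isNormal_of_digits`). As `q` tends to infinity, `∑ 1 / q i` is `o(n)`, so insertions have
density zero. Elsewhere the orbit of `x` stays close to `squareFrac`, and distribution normality
follows (`tendsto_count_lt_of_close`).

Everything is recursive in `q` and `L`. The sequence `L` serves only as a modulus for `q → ∞`: it
tells when a level may be used with all its letters admissible (`lt_of_L_le`). A real with a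
computable base sequence and digits is computable (`isComputableReal_of_bounds`). -/

namespace CantorSeries

open Filter Topology

/-! ### Recursive definition of the digit sequence -/

/-- The product `q_1 ⋯ q_n`. -/
def prodQ (q : ℕ → ℕ) : ℕ → ℕ
  | 0 => 1
  | n + 1 => prodQ q n * q (n + 1)

/-- The numerator over `q_1 ⋯ q_n` of the partial sum `∑_{i=1}^n a_i / (q_1 ⋯ q_i)`. -/
def cantorNum (q a : ℕ → ℕ) : ℕ → ℕ
  | 0 => 0
  | n + 1 => cantorNum q a n * q (n + 1) + a (n + 1)

/-- The integer part of `∑_{i=1}^n 1 / q_i`. -/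
def harmonicFloor (q : ℕ → ℕ) (n : ℕ) : ℕ :=
  cantorNum q (fun m => prodQ q (m - 1)) n / prodQ q n

/-- The length of the chunk that lists all words of length `b` over `{0, …, b - 1}`, each of them
followed by a separator. -/
def chunkLen (b : ℕ) : ℕ := b ^ b * (b + 1)

/-- The total length of the first `r` chunks, for the levels `β 0, …, β (r - 1)`. -/
def totalLen (β : ℕ → ℕ) : ℕ → ℕ
  | 0 => 0
  | r + 1 => totalLen β r + chunkLen (β r)

/-- The level of the `r`-th chunk: it increases as soon as the cost `c` of the next level is at
most `r`. -/
def level (c : ℕ → ℕ) : ℕ → ℕ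
  | 0 => 0
  | r + 1 => if c (level c r + 1) ≤ r + 1 then level c r + 1 else level c r

/-- The pair `(r, t)` of the index of the current chunk and of the offset in this chunk
of the position `n`. The next chunk starts once the current one is completed and the budget
`F` allows for it. -/
def state (β F : ℕ → ℕ) : ℕ → ℕ × ℕ
  | 0 => (0, 0)
  | n + 1 =>
    if chunkLen (β (state β F n).1) ≤ (state β F n).2 + 1 ∧
        2 * totalLen β ((state β F n).1 + 2) ≤ F (n + 1) then
      ((state β F n).1 + 1, 0)
    else ((state β F n).1, (state β F n).2 + 1)

/-- A digit of a chunk of level `b` is to be used at offset `t`. -/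
def IsInserted (b t : ℕ) : Prop := t < chunkLen b ∧ t % (b + 1) < b

instance (b t : ℕ) : Decidable (IsInserted b t) := inferInstanceAs (Decidable (_ ∧ _))

/-- The digit of a chunk of level `b` at offset `t`. -/
def chunkDigit (b t : ℕ) : ℕ := t / (b + 1) / b ^ (t % (b + 1)) % b

/-- A digit close to `q_n y_{n-1}` for a uniformly distributed sequence `y`, and tending to
infinity with `q_n`. -/
def spreadDigit (q : ℕ → ℕ) (n : ℕ) : ℕ :=
  max (Nat.sqrt (q n))
    ((q n - 1) * (n - 1 - Nat.sqrt (n - 1) ^ 2) / (2 * Nat.sqrt (n - 1) + 1))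

/-- Chunks inserted into the spread digits, for levels `β` and budget `F`. -/
def mixedDigit (q β F : ℕ → ℕ) (n : ℕ) : ℕ :=
  if IsInserted (β (state β F n).1) (state β F n).2 then
    chunkDigit (β (state β F n).1) (state β F n).2
  else spreadDigit q n

/-! ### Computability of the digit sequence -/

section Computability

variable {α σ : Type*} [Primcodable α] [Primcodable σ]

theorem computable_add {f g : α → ℕ} (hf : Computable f) (hg : Computable g) :
    Computable fun x => f x + g x := Primrec.nat_add.to_comp.comp hf hg

theorem computable_sub {f g : α → ℕ} (hf : Computable f) (hg : Computable g) :
    Computable fun x => f x - g x := Primrec.nat_sub.to_comp.comp hf hg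

theorem computable_mul {f g : α → ℕ} (hf : Computable f) (hg : Computable g) :
    Computable fun x => f x * g x := Primrec.nat_mul.to_comp.comp hf hg

theorem computable_div {f g : α → ℕ} (hf : Computable f) (hg : Computable g) :
    Computable fun x => f x / g x := Primrec.nat_div.to_comp.comp hf hg

theorem computable_mod {f g : α → ℕ} (hf : Computable f) (hg : Computable g) :
    Computable fun x => f x % g x := Primrec.nat_mod.to_comp.comp hf hg

theorem computable_max {f g : α → ℕ} (hf : Computable f) (hg : Computable g) :
    Computable fun x => max (f x) (g x) := Primrec.nat_max.to_comp.comp hf hg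

theorem computable_pow {f g : α → ℕ} (hf : Computable f) (hg : Computable g) :
    Computable fun x => f x ^ g x := by
  have h : Primrec₂ ((· ^ ·) : ℕ → ℕ → ℕ) := Primrec₂.unpaired'.1 Nat.Primrec.pow
  exact h.to_comp.comp hf hg

theorem computable_sqrt {f : α → ℕ} (hf : Computable f) :
    Computable fun x => Nat.sqrt (f x) := Primrec.nat_sqrt.to_comp.comp hf

theorem computablePred_le {f g : α → ℕ} (hf : Computable f) (hg : Computable g) :
    ComputablePred fun x => f x ≤ g x :=
  Computable.computablePred (Primrec.nat_le.decide.to_comp.comp hf hg)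

theorem computablePred_lt {f g : α → ℕ} (hf : Computable f) (hg : Computable g) :
    ComputablePred fun x => f x < g x :=
  Computable.computablePred (Primrec.nat_lt.decide.to_comp.comp hf hg)

theorem computablePred_eq {f g : α → ℕ} (hf : Computable f) (hg : Computable g) :
    ComputablePred fun x => f x = g x :=
  Computable.computablePred (Primrec.eq.decide.to_comp.comp hf hg)

theorem computablePred_and {p r : α → Prop} (hp : ComputablePred p) (hr : ComputablePred r) :
    ComputablePred fun x => p x ∧ r x := by
  classical
  refine Computable.computablePred ((Primrec.and.to_comp.comp hp.decide hr.decide).of_eq ?_)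
  simp

theorem computable_ite {p : α → Prop} [DecidablePred p] (hp : ComputablePred p) {f g : α → σ}
    (hf : Computable f) (hg : Computable g) : Computable fun x => if p x then f x else g x :=
  (hp.decide.cond hf hg).of_eq fun x => by simp [Bool.cond_decide]

/-- Products, numerators, total lengths, levels and states are all given by a one-step recursion, so
each of them falls under this case of `Computable.nat_rec`. -/
theorem computable_of_rec {f : ℕ → σ} (g : ℕ × σ → σ) (hg : Computable g)
    (h : ∀ n, f (n + 1) = g (n, f n)) : Computable f := by
  refine (Computable.nat_rec Computable.id (Computable.const (f 0))
    (hg.comp Computable.snd).to₂).of_eq fun n => ?_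
  induction n with
  | zero => rfl
  | succ n ih => rw [h, ← ih]; rfl

variable {q a β F : ℕ → ℕ}

theorem computable_prodQ (hq : Computable q) : Computable (prodQ q) :=
  computable_of_rec (fun p => p.2 * q (p.1 + 1))
    (computable_mul Computable.snd (hq.comp (Computable.succ.comp Computable.fst))) fun _ => rfl

theorem computable_cantorNum (hq : Computable q) (ha : Computable a) :
    Computable (cantorNum q a) :=
  computable_of_rec (fun p => p.2 * q (p.1 + 1) + a (p.1 + 1))
    (computable_add
      (computable_mul Computable.snd (hq.comp (Computable.succ.comp Computable.fst)))
      (ha.comp (Computable.succ.comp Computable.fst))) fun _ => rfl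

theorem computable_harmonicFloor (hq : Computable q) : Computable (harmonicFloor q) :=
  computable_div
    (computable_cantorNum hq ((computable_prodQ hq).comp Computable.pred))
    (computable_prodQ hq)

theorem computable_chunkLen {f : α → ℕ} (hf : Computable f) :
    Computable fun x => chunkLen (f x) :=
  computable_mul (computable_pow hf hf) (Computable.succ.comp hf)

theorem computable_totalLen (hβ : Computable β) : Computable (totalLen β) :=
  computable_of_rec (fun p => p.2 + chunkLen (β p.1))
    (computable_add Computable.snd (computable_chunkLen (hβ.comp Computable.fst))) fun _ => rfl

theorem computable_level {c : ℕ → ℕ} (hc : Computable c) : Computable (level c) :=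
  computable_of_rec (fun p => if c (p.2 + 1) ≤ p.1 + 1 then p.2 + 1 else p.2)
    (computable_ite (computablePred_le (hc.comp (Computable.succ.comp Computable.snd))
      (Computable.succ.comp Computable.fst)) (Computable.succ.comp Computable.snd)
      Computable.snd) fun _ => rfl

theorem computable_state (hβ : Computable β) (hF : Computable F) : Computable (state β F) := by
  have hr : Computable fun p : ℕ × ℕ × ℕ => p.2.1 := Computable.fst.comp Computable.snd
  have ht : Computable fun p : ℕ × ℕ × ℕ => p.2.2 + 1 :=
    Computable.succ.comp (Computable.snd.comp Computable.snd)
  exact computable_of_rec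
    (fun p => if chunkLen (β p.2.1) ≤ p.2.2 + 1 ∧ 2 * totalLen β (p.2.1 + 2) ≤ F (p.1 + 1) then
      (p.2.1 + 1, 0) else (p.2.1, p.2.2 + 1))
    (computable_ite
      (computablePred_and (computablePred_le (computable_chunkLen (hβ.comp hr)) ht)
        (computablePred_le (computable_mul (Computable.const 2)
          ((computable_totalLen hβ).comp (computable_add hr (Computable.const 2))))
          (hF.comp (Computable.succ.comp Computable.fst))))
      ((Computable.succ.comp hr).pair (Computable.const 0)) (hr.pair ht)) fun _ => rfl

theorem computable_spreadDigit (hq : Computable q) : Computable (spreadDigit q) :=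
  computable_max (computable_sqrt hq)
    (computable_div
      (computable_mul (Computable.pred.comp hq)
        (computable_sub Computable.pred
          (computable_pow (computable_sqrt Computable.pred) (Computable.const 2))))
      (Computable.succ.comp
        (computable_mul (Computable.const 2) (computable_sqrt Computable.pred))))

theorem computable_mixedDigit (hq : Computable q) (hβ : Computable β) (hF : Computable F) :
    Computable (mixedDigit q β F) := by
  have hb : Computable fun n => β (state β F n).1 :=
    hβ.comp (Computable.fst.comp (computable_state hβ hF))
  have ht : Computable fun n => (state β F n).2 := Computable.snd.comp (computable_state hβ hF)
  have hm := computable_mod ht (Computable.succ.comp hb)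
  exact computable_ite
    (computablePred_and (computablePred_lt ht (computable_chunkLen hb)) (computablePred_lt hm hb))
    (computable_mod (computable_div (computable_div ht (Computable.succ.comp hb))
      (computable_pow hb hm)) hb)
    (computable_spreadDigit hq)

end Computability

/-! ### Reals from Cantor series digits, and their computability -/

section CantorReal

variable {q a : ℕ → ℕ}

theorem prodQ_cast (q : ℕ → ℕ) (n : ℕ) : (prodQ q n : ℝ) = ∏ i ∈ Finset.Icc 1 n, (q i : ℝ) := by
  induction n with
  | zero => simp [prodQ]
  | succ n ih => rw [Finset.prod_Icc_succ_top (by omega), ← ih, prodQ]; push_cast; rfl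

theorem two_pow_le_prodQ (hq : IsBasic q) (n : ℕ) : 2 ^ n ≤ prodQ q n := by
  induction n with
  | zero => simp [prodQ]
  | succ n ih => rw [pow_succ, prodQ]; exact Nat.mul_le_mul ih (hq _ (by omega))

theorem prodQ_pos (hq : IsBasic q) (n : ℕ) : 0 < prodQ q n :=
  lt_of_lt_of_le (by positivity) (two_pow_le_prodQ hq n)

theorem cantorNum_div_prodQ (hq : IsBasic q) (a : ℕ → ℕ) (n : ℕ) :
    (cantorNum q a n : ℝ) / prodQ q n = ∑ i ∈ Finset.Icc 1 n, (a i : ℝ) / prodQ q i := by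
  induction n with
  | zero => simp [cantorNum]
  | succ n ih =>
    have h1 : (prodQ q n : ℝ) ≠ 0 := by exact_mod_cast (prodQ_pos hq n).ne'
    have h2 : (q (n + 1) : ℝ) ≠ 0 := by
      have := hq (n + 1) (by omega)
      exact_mod_cast (by omega : q (n + 1) ≠ 0)
    rw [Finset.sum_Icc_succ_top (by omega), ← ih, cantorNum, prodQ]
    push_cast
    field_simp

/-- Digits that are not eventually maximal determine a real number between the partial sums. -/
theorem exists_real_of_digits (hq : IsBasic q) (ha : ∀ n, 1 ≤ n → a n < q n)
    (hinf : ∀ m, ∃ n, m ≤ n ∧ a (n + 1) + 1 < q (n + 1)) :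
    ∃ x : ℝ, ∀ n, (cantorNum q a n : ℝ) ≤ prodQ q n * x ∧
      prodQ q n * x < cantorNum q a n + 1 := by
  have hD : ∀ n, (0 : ℝ) < prodQ q n := fun n => by exact_mod_cast prodQ_pos hq n
  have hqp : ∀ n, (0 : ℝ) < q (n + 1) := fun n => by
    have := hq (n + 1) (by omega)
    exact_mod_cast (by omega : 0 < q (n + 1))
  have hmono : Monotone fun n => (cantorNum q a n : ℝ) / prodQ q n := by
    refine monotone_nat_of_le_succ fun n => ?_
    rw [div_le_div_iff₀ (hD _) (hD _), cantorNum, prodQ]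
    push_cast
    nlinarith [mul_nonneg (Nat.cast_nonneg (α := ℝ) (a (n + 1))) (hD n).le]
  have hstep : ∀ n, (cantorNum q a (n + 1) : ℝ) + 1 ≤ (cantorNum q a n + 1) * q (n + 1) := by
    intro n
    have : (a (n + 1) : ℝ) + 1 ≤ q (n + 1) := by exact_mod_cast ha (n + 1) (by omega)
    rw [cantorNum]; push_cast; linarith
  have hanti : Antitone fun n => ((cantorNum q a n : ℝ) + 1) / prodQ q n := by
    refine antitone_nat_of_succ_le fun n => ?_
    rw [div_le_div_iff₀ (hD _) (hD _), prodQ]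
    push_cast
    nlinarith [mul_le_mul_of_nonneg_right (hstep n) (hD n).le]
  have hle : ∀ n m, (cantorNum q a n : ℝ) / prodQ q n ≤ (cantorNum q a m + 1) / prodQ q m := by
    intro n m
    calc _ ≤ (cantorNum q a (max n m) : ℝ) / prodQ q (max n m) := hmono (le_max_left _ _)
      _ ≤ (cantorNum q a (max n m) + 1) / prodQ q (max n m) := by
        have := hD (max n m); gcongr; linarith
      _ ≤ _ := hanti (le_max_right _ _)
  refine ⟨⨆ n, (cantorNum q a n : ℝ) / prodQ q n, fun n => ⟨?_, ?_⟩⟩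
  · rw [mul_comm, ← div_le_iff₀ (hD n)]
    exact le_ciSup (f := fun n => (cantorNum q a n : ℝ) / prodQ q n)
      ⟨(cantorNum q a 0 + 1 : ℝ) / prodQ q 0, by rintro _ ⟨m, rfl⟩; exact hle m 0⟩ n
  -- At a digit that is not maximal the upper bounds drop strictly. This keeps the supremum off the
  -- right endpoint, where a carry would change the digits.
  · obtain ⟨m, hm, hlt⟩ := hinf n
    have hlt' : (a (m + 1) : ℝ) + 1 < q (m + 1) := by exact_mod_cast hlt
    rw [mul_comm, ← lt_div_iff₀ (hD n)]
    calc _ ≤ ((cantorNum q a (m + 1) : ℝ) + 1) / prodQ q (m + 1) := ciSup_le fun k => hle k _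
      _ < (cantorNum q a m + 1) / prodQ q m := by
        rw [div_lt_div_iff₀ (hD _) (hD _), prodQ, cantorNum]
        push_cast
        nlinarith [mul_lt_mul_of_pos_right hlt' (hD m)]
      _ ≤ _ := hanti hm

theorem T_eq_of_bounds {x : ℝ} (hx : ∀ n, (cantorNum q a n : ℝ) ≤ prodQ q n * x ∧
    prodQ q n * x < cantorNum q a n + 1) (n : ℕ) :
    T q n x = prodQ q n * x - cantorNum q a n := by
  have h : ⌊(prodQ q n : ℝ) * x⌋ = (cantorNum q a n : ℤ) := by
    rw [Int.floor_eq_iff]; exact_mod_cast hx n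
  rw [T, ← prodQ_cast, ← Int.self_sub_floor, h]
  simp

theorem digit_eq_of_bounds {x : ℝ} (hx : ∀ n, (cantorNum q a n : ℝ) ≤ prodQ q n * x ∧
    prodQ q n * x < cantorNum q a n + 1) {n : ℕ} (hn : 1 ≤ n) : digit q x n = a n := by
  obtain ⟨n, rfl⟩ : ∃ m, n = m + 1 := ⟨n - 1, by omega⟩
  have h1 := hx (n + 1)
  rw [prodQ, cantorNum] at h1
  push_cast at h1
  rw [digit, Nat.add_sub_cancel, T_eq_of_bounds hx, Nat.floor_eq_iff]
  · constructor <;> nlinarith [h1.1, h1.2]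
  · have := (hx n).1
    exact mul_nonneg (Nat.cast_nonneg _) (by linarith)

theorem digit_two (x : ℝ) (hx : 0 ≤ x) (n : ℕ) :
    digit (fun _ => 2) x (n + 1) = ⌊(2 : ℝ) ^ (n + 1) * x⌋₊ % 2 := by
  have h0 : 0 ≤ (2 : ℝ) ^ n * x := by positivity
  set k := ⌊(2 : ℝ) ^ n * x⌋₊ with hk
  have hT : T (fun _ => 2) n x = (2 : ℝ) ^ n * x - k := by
    rw [T]
    simp only [Finset.prod_const, Nat.card_Icc, Nat.add_sub_cancel, Nat.cast_ofNat]
    rw [← Int.self_sub_floor, hk, natCast_floor_eq_intCast_floor h0]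
  have hlt := digit_expansion (q := fun _ => 2) (fun _ _ => le_rfl) x |>.1 (n + 1) (by omega)
  have hfl : ⌊(2 : ℝ) ^ (n + 1) * x⌋₊ = 2 * k + digit (fun _ => 2) x (n + 1) := by
    rw [Nat.floor_eq_iff (by positivity), digit, Nat.add_sub_cancel, hT]
    have hnn : 0 ≤ ((2 : ℕ) : ℝ) * ((2 : ℝ) ^ n * x - k) := by
      have := Nat.floor_le h0
      push_cast
      linarith
    have h1 := Nat.floor_le hnn
    have h2 := Nat.lt_floor_add_one (((2 : ℕ) : ℝ) * ((2 : ℝ) ^ n * x - k))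
    push_cast at h1 h2 ⊢
    rw [pow_succ]
    constructor <;> linarith
  omega

/-- The function is a lookup in a finite table with default value 0. -/
theorem computable_of_eventually_zero {f : ℕ → ℕ} {m : ℕ} (hf : ∀ n, m ≤ n → f n = 0) :
    Computable f := by
  refine (((Primrec.list_getD 0).comp (Primrec.const ((List.range m).map f))
    Primrec.id).of_eq fun n => ?_).to_comp
  by_cases h : n < m
  · simp [List.getD_eq_getElem?_getD, h]
  · simp [List.getD_eq_getElem?_getD, hf n (by omega), h]

/-- A Cantor series with computable base and digits has a computable sum. -/
theorem isComputableReal_of_bounds (hq : IsBasic q) (hqc : Computable q) (hac : Computable a)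
    {x : ℝ} (hx : ∀ n, (cantorNum q a n : ℝ) ≤ prodQ q n * x ∧
      prodQ q n * x < cantorNum q a n + 1) : IsComputableReal x := by
  have hx0 : 0 ≤ x := by
    have := (hx 0).1
    simpa [cantorNum, prodQ] using this
  have hD : ∀ n, (0 : ℝ) < prodQ q n := fun n => by exact_mod_cast prodQ_pos hq n
  refine ⟨2, le_rfl, fun n => ⌊(2 : ℝ) ^ n * x⌋₊ % 2, ?_, fun n hn => ?_⟩
  swap
  · obtain ⟨n, rfl⟩ : ∃ m, n = m + 1 := ⟨n - 1, by omega⟩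
    exact (digit_two x hx0 n).symm
  -- Dyadic `x` are treated apart because the search used below might not terminate for them. The
  -- case distinction need not be effective, since only the existence of an algorithm is claimed.
  by_cases hdy : ∃ m k : ℕ, (2 : ℝ) ^ m * x = k
  · obtain ⟨m, k, hk⟩ := hdy
    refine computable_of_eventually_zero (m := m + 1) fun n hn => ?_
    obtain ⟨d, rfl⟩ := Nat.exists_eq_add_of_le hn
    have : (2 : ℝ) ^ (m + 1 + d) * x = ((2 * (2 ^ d * k) : ℕ) : ℝ) := by
      push_cast; rw [← hk]; ring
    rw [this, Nat.floor_natCast]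
    exact Nat.mul_mod_right _ _
  push Not at hdy
  have hfloor : ∀ n N, 2 ^ n * cantorNum q a N / prodQ q N ≤ ⌊(2 : ℝ) ^ n * x⌋₊ ∧
      ⌊(2 : ℝ) ^ n * x⌋₊ ≤ 2 ^ n * (cantorNum q a N + 1) / prodQ q N := by
    intro n N
    obtain ⟨h1, h2⟩ := hx N
    have hp : (0 : ℝ) < 2 ^ n := by positivity
    constructor
    · rw [← Nat.floor_div_eq_div (K := ℝ)]
      apply Nat.floor_le_floor
      rw [div_le_iff₀ (hD N)]
      push_cast
      nlinarith
    · rw [← Nat.floor_div_eq_div (K := ℝ)]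
      apply Nat.floor_le_floor
      rw [le_div_iff₀ (hD N)]
      push_cast
      nlinarith
  have hex : ∀ n, ∃ N, 2 ^ n * cantorNum q a N / prodQ q N =
      2 ^ n * (cantorNum q a N + 1) / prodQ q N := by
    intro n
    set k := ⌊(2 : ℝ) ^ n * x⌋₊ with hk
    have hk1 : (k : ℝ) < 2 ^ n * x :=
      lt_of_le_of_ne (Nat.floor_le (by positivity)) (hdy n k).symm
    have hk2 : (2 : ℝ) ^ n * x < k + 1 := Nat.lt_floor_add_one _
    -- `N` makes the scaled error `2 ^ n / prodQ q N` smaller than the distance from `2 ^ n * x` to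
    -- both neighbouring integers, so the lower and the upper approximation have the same integer
    -- part.
    obtain ⟨N, hN⟩ := pow_unbounded_of_one_lt
      ((2 : ℝ) ^ n / min (2 ^ n * x - k) (k + 1 - 2 ^ n * x)) (one_lt_two : (1 : ℝ) < 2)
    have hmin : 0 < min (2 ^ n * x - k) (k + 1 - 2 ^ n * x) := lt_min (by linarith) (by linarith)
    rw [div_lt_iff₀ hmin] at hN
    have hN' : (2 : ℝ) ^ n < prodQ q N * min (2 ^ n * x - k) (k + 1 - 2 ^ n * x) :=
      hN.trans_le (mul_le_mul_of_nonneg_right (by exact_mod_cast two_pow_le_prodQ hq N) hmin.le)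
    have hl := hN'.trans_le (mul_le_mul_of_nonneg_left (min_le_left _ _) (hD N).le)
    have hr := hN'.trans_le (mul_le_mul_of_nonneg_left (min_le_right _ _) (hD N).le)
    obtain ⟨h1, h2⟩ := hx N
    have hp : (0 : ℝ) < 2 ^ n := by positivity
    refine ⟨N, le_antisymm ((hfloor n N).1.trans (hfloor n N).2) ?_⟩
    rw [Nat.le_div_iff_mul_le (prodQ_pos hq N)]
    have hlt : 2 ^ n * (cantorNum q a N + 1) / prodQ q N < k + 1 := by
      rw [Nat.div_lt_iff_lt_mul (prodQ_pos hq N)]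
      have : (2 : ℝ) ^ n * (cantorNum q a N + 1) < (k + 1) * prodQ q N := by nlinarith
      exact_mod_cast this
    have hge : (k : ℝ) * prodQ q N ≤ 2 ^ n * cantorNum q a N := by nlinarith
    have hge' : k * prodQ q N ≤ 2 ^ n * cantorNum q a N := by exact_mod_cast hge
    exact (Nat.mul_le_mul_right _ (by omega)).trans hge'
  have hA := computable_cantorNum hqc hac
  have hDc := computable_prodQ hqc
  have hfind := Computable.find (P := fun n N => 2 ^ n * cantorNum q a N / prodQ q N =
      2 ^ n * (cantorNum q a N + 1) / prodQ q N) (computablePred_eq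
      (computable_div (computable_mul (computable_pow (Computable.const 2) Computable.fst)
        (hA.comp Computable.snd)) (hDc.comp Computable.snd))
      (computable_div (computable_mul (computable_pow (Computable.const 2) Computable.fst)
        (Computable.succ.comp (hA.comp Computable.snd))) (hDc.comp Computable.snd))) hex
  refine (computable_mod (computable_div (computable_mul
    (computable_pow (Computable.const 2) Computable.id) (hA.comp hfind)) (hDc.comp hfind))
    (Computable.const 2)).of_eq fun n => ?_
  have h1 := hfloor n (Nat.find (hex n))
  have h2 := Nat.find_spec (hex n)
  simp only [id]
  congr 1
  omega

end CantorReal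

/-! ### Slowly growing levels -/

section Level

variable {c : ℕ → ℕ}

/-- The level is raised only when its new cost is affordable, and the budget `r` never decreases; `c
0 = 0` covers the initial level. -/
theorem cost_level_le (hc : c 0 = 0) (r : ℕ) : c (level c r) ≤ r := by
  induction r with
  | zero => simp [level, hc]
  | succ r ih =>
    rw [level]
    split_ifs with h
    · exact h
    · omega

theorem level_monotone (c : ℕ → ℕ) : Monotone (level c) := by
  refine monotone_nat_of_le_succ fun r => ?_
  rw [level]
  split_ifs <;> omega

theorem tendsto_level (c : ℕ → ℕ) : Tendsto (level c) atTop atTop := by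
  refine tendsto_atTop_atTop_of_monotone (level_monotone c) fun m => ?_
  induction m with
  | zero => exact ⟨0, Nat.zero_le _⟩
  | succ m ih =>
    obtain ⟨r, hr⟩ := ih
    by_contra! h
    have heq : ∀ s, r ≤ s → level c s = m := fun s hs =>
      le_antisymm (Nat.lt_succ_iff.1 (h s)) (hr.trans (level_monotone c hs))
    -- A level stuck at `m` would be raised once the index reaches the cost of `m + 1`.
    have h1 := heq (max r (c (m + 1)) + 1) (by omega)
    rw [level, heq _ (le_max_left _ _), if_pos (by omega)] at h1
    omega

end Level

/-! ### Placement of the chunks under the budget -/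

section State

variable {β F : ℕ → ℕ}

theorem state_fst_le (β F : ℕ → ℕ) (n : ℕ) : (state β F n).1 ≤ n := by
  induction n with
  | zero => simp [state]
  | succ n ih => rw [state]; split_ifs <;> simp only <;> omega

/-- An unbounded budget eventually pays for the next chunk. The offset keeps counting beyond the end
of the current chunk until the first time when both conditions for a new one hold. -/
theorem exists_next_chunk (hF : Tendsto F atTop atTop) {n r : ℕ} (h : state β F n = (r, 0)) :
    ∃ n', state β F n' = (r + 1, 0) ∧ n < n' ∧ n + chunkLen (β r) ≤ n' ∧
      ∀ t, n + t < n' → state β F (n + t) = (r, t) := by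
  have hex : ∃ j, chunkLen (β r) ≤ j + 1 ∧ 2 * totalLen β (r + 2) ≤ F (n + j + 1) := by
    obtain ⟨m, hm⟩ := eventually_atTop.1 (hF.eventually_ge_atTop (2 * totalLen β (r + 2)))
    exact ⟨m + chunkLen (β r), by omega, hm _ (by omega)⟩
  have hst : ∀ t, t ≤ Nat.find hex → state β F (n + t) = (r, t) := by
    intro t ht
    induction t with
    | zero => exact h
    | succ t ih =>
      rw [← add_assoc, state, ih (by omega), if_neg (Nat.find_min hex (by omega))]
  refine ⟨n + Nat.find hex + 1, ?_, by omega, ?_, fun t ht => hst t (by omega)⟩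
  · rw [state, hst _ le_rfl, if_pos (Nat.find_spec hex)]
  · have := (Nat.find_spec hex).1
    omega

/-- The positions at which the chunks start. -/
theorem exists_chunk_starts (hF : Tendsto F atTop atTop) (β : ℕ → ℕ) :
    ∃ s : ℕ → ℕ, s 0 = 0 ∧ StrictMono s ∧ (∀ r, s r + chunkLen (β r) ≤ s (r + 1)) ∧
      ∀ r t, s r + t < s (r + 1) → state β F (s r + t) = (r, t) := by
  choose! nx h1 h2 h3 h4 using fun n r => exists_next_chunk (β := β) hF (n := n) (r := r)
  let s : ℕ → ℕ := fun r => Nat.rec 0 (fun r n => nx n r) r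
  have hs : ∀ r, state β F (s r) = (r, 0) := by
    intro r
    induction r with
    | zero => rfl
    | succ r ih => exact h1 _ _ ih
  exact ⟨s, rfl, strictMono_nat_of_lt_succ fun r => h2 _ _ (hs r), fun r => h3 _ _ (hs r),
    fun r => h4 _ _ (hs r)⟩

theorem card_inserted_le_totalLen (β F : ℕ → ℕ) (n : ℕ) :
    ((Finset.Icc 1 n).filter fun i => IsInserted (β (state β F i).1) (state β F i).2).card ≤
      totalLen β ((state β F n).1 + 1) := by
  -- For the induction the current chunk may contribute only the offsets reached so far; the minimum
  -- equals the full chunk length at the moment the next chunk starts.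
  suffices h : ((Finset.Icc 1 n).filter fun i =>
      IsInserted (β (state β F i).1) (state β F i).2).card ≤
      totalLen β (state β F n).1 + min ((state β F n).2 + 1) (chunkLen (β (state β F n).1)) by
    rw [totalLen]; omega
  induction n with
  | zero => simp
  | succ n ih =>
    rw [← Finset.insert_Icc_right_eq_Icc_add_one (by omega), Finset.filter_insert]
    have hcard := Finset.card_insert_le (n + 1)
      ((Finset.Icc 1 n).filter fun i => IsInserted (β (state β F i).1) (state β F i).2)
    have key : (if IsInserted (β (state β F (n + 1)).1) (state β F (n + 1)).2 then 1 else 0) +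
        (totalLen β (state β F n).1 +
          min ((state β F n).2 + 1) (chunkLen (β (state β F n).1))) ≤
        totalLen β (state β F (n + 1)).1 +
          min ((state β F (n + 1)).2 + 1) (chunkLen (β (state β F (n + 1)).1)) := by
      have hlt : ∀ b t, IsInserted b t → t < chunkLen b := fun b t h => h.1
      rw [state]
      split_ifs with h1 h2 h2 <;> simp only [totalLen] at h1 h2 ⊢
      all_goals first | have := hlt _ _ h2 | skip
      all_goals omega
    split_ifs at key ⊢ with h <;> omega

/-- The budget is tested when a chunk starts and only grows afterwards. The extra term pays for the
first chunk, which starts without a test. -/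
theorem two_mul_totalLen_le (hF : Monotone F) (n : ℕ) :
    2 * totalLen β ((state β F n).1 + 1) ≤ F n + 2 * totalLen β 1 := by
  induction n with
  | zero => simp [state]
  | succ n ih =>
    have := hF (Nat.le_succ n)
    rw [state]
    split_ifs with h
    · exact h.2.trans (Nat.le_add_right _ _)
    · exact ih.trans (Nat.add_le_add_right this _)

end State

/-! ### Occurrences of blocks in one chunk -/

section Chunk

theorem chunkDigit_offset {b t j : ℕ} (h : t % (b + 1) + j ≤ b) :
    (t + j) / (b + 1) = t / (b + 1) ∧ (t + j) % (b + 1) = t % (b + 1) + j := by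
  exact (Nat.div_mod_unique (Nat.add_one_pos b)).2
    ⟨by have := Nat.mod_add_div t (b + 1); omega, by omega⟩

theorem add_lt_chunkLen {b t j : ℕ} (ht : t < chunkLen b) (h : t % (b + 1) + j ≤ b) :
    t + j < chunkLen b := by
  unfold chunkLen at *
  rw [← Nat.div_lt_iff_lt_mul (Nat.add_one_pos b)] at ht ⊢
  rwa [(chunkDigit_offset h).1]

/-- An occurrence of `B` inside a single word of a chunk of level `b`, at offset `t`. -/
def ChunkMatch (b : ℕ) {k : ℕ} (B : Fin k → ℕ) (t : ℕ) : Prop :=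
  t % (b + 1) + k ≤ b ∧ ∀ j : Fin k, t / (b + 1) / b ^ (t % (b + 1) + j) % b = B j

instance (b : ℕ) {k : ℕ} (B : Fin k → ℕ) (t : ℕ) : Decidable (ChunkMatch b B t) :=
  inferInstanceAs (Decidable (_ ∧ _))

/-- A word with a position in it or at its separator, as an offset in the chunk of level `b`. -/
def wordEquiv (b : ℕ) : (Fin b → Fin b) × Fin (b + 1) ≃ Fin (chunkLen b) :=
  (finFunctionFinEquiv.prodCongr (Equiv.refl _)).trans finProdFinEquiv

/-- The word is coded as a number in base `b`, which becomes the quotient by `b + 1`, with the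
position as remainder. This is the decoding built into `chunkDigit`. -/
theorem wordEquiv_spec (b : ℕ) (f : Fin b → Fin b) (p : Fin (b + 1)) :
    (wordEquiv b (f, p) : ℕ) % (b + 1) = p ∧
      ∀ i : Fin b, (wordEquiv b (f, p) : ℕ) / (b + 1) / b ^ (i : ℕ) % b = f i := by
  have hval : (wordEquiv b (f, p) : ℕ) = p + (b + 1) * (finFunctionFinEquiv f : ℕ) := rfl
  obtain ⟨h1, h2⟩ := (Nat.div_mod_unique (Nat.add_one_pos b)).2 ⟨hval.symm, p.2⟩
  refine ⟨h2, fun i => ?_⟩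
  rw [h1, ← finFunctionFinEquiv_symm_apply_val, Equiv.symm_apply_apply]

theorem chunkMatch_wordEquiv {b k : ℕ} (B : Fin k → ℕ) (f : Fin b → Fin b) (p : Fin (b + 1)) :
    ChunkMatch b B (wordEquiv b (f, p)) ↔
      ∃ h : (p : ℕ) + k ≤ b, ∀ j : Fin k, (f ⟨p + j, by omega⟩ : ℕ) = B j := by
  obtain ⟨h1, h2⟩ := wordEquiv_spec b f p
  unfold ChunkMatch
  rw [h1]
  constructor
  · rintro ⟨h, h'⟩
    exact ⟨h, fun j => by rw [← h' j, ← h2 ⟨p + j, by omega⟩]⟩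
  · rintro ⟨h, h'⟩
    exact ⟨h, fun j => by rw [← h' j, ← h2 ⟨p + j, by omega⟩]⟩

theorem card_chunkMatch {b k : ℕ} (B : Fin k → ℕ) :
    ((Finset.range (chunkLen b)).filter (ChunkMatch b B)).card =
      ∑ p : Fin (b + 1), ∑ f : Fin b → Fin b,
        if ChunkMatch b B (wordEquiv b (f, p)) then 1 else 0 := by
  rw [Finset.card_filter, Finset.sum_range, ← Equiv.sum_comp (wordEquiv b),
    Fintype.sum_prod_type_right]

/-- All blocks of the same length occur equally often in a chunk. -/
theorem card_chunkMatch_eq {b k : ℕ} (B₁ B₂ : Fin k → ℕ) (h₁ : ∀ j, B₁ j < b)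
    (h₂ : ∀ j, B₂ j < b) :
    ((Finset.range (chunkLen b)).filter (ChunkMatch b B₁)).card =
      ((Finset.range (chunkLen b)).filter (ChunkMatch b B₂)).card := by
  rw [card_chunkMatch, card_chunkMatch]
  refine Finset.sum_congr rfl fun p _ => ?_
  -- For a fixed starting position `p`, swapping the letters `B₁ j` and `B₂ j` at place `p + j` is a
  -- bijection of words that carries occurrences of `B₁` at `p` to occurrences of `B₂` at `p`.
  let e : (Fin b → Fin b) ≃ (Fin b → Fin b) := Equiv.piCongrRight fun i =>
    if h : (p : ℕ) ≤ i ∧ (i : ℕ) - p < k then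
      Equiv.swap ⟨B₁ ⟨i - p, h.2⟩, h₁ _⟩ ⟨B₂ ⟨i - p, h.2⟩, h₂ _⟩
    else Equiv.refl _
  refine Fintype.sum_equiv e _ _ fun f => ?_
  refine if_congr ?_ rfl rfl
  rw [chunkMatch_wordEquiv, chunkMatch_wordEquiv]
  refine exists_congr fun h => forall_congr' fun j => ?_
  have he : e f ⟨p + j, by omega⟩ =
      Equiv.swap ⟨B₁ j, h₁ _⟩ ⟨B₂ j, h₂ _⟩ (f ⟨p + j, by omega⟩) := by
    simp [e, Equiv.piCongrRight]
  have hswap : ∀ u v w : Fin b, (w : ℕ) = u ↔ (Equiv.swap u v w : ℕ) = v := fun u v w => by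
    rw [← Fin.ext_iff, ← Fin.ext_iff, Equiv.swap_apply_eq_iff, Equiv.swap_apply_right]
  rw [he]
  exact hswap ⟨B₁ j, h₁ j⟩ ⟨B₂ j, h₂ j⟩ _

theorem card_chunkMatch_pos {b k : ℕ} (B : Fin k → ℕ) (hB : ∀ j, B j < b) (hk : k ≤ b)
    (hb : 0 < b) : 0 < ((Finset.range (chunkLen b)).filter (ChunkMatch b B)).card := by
  -- The word that begins with `B` and is padded with zeros gives an occurrence at its first
  -- position.
  let f : Fin b → Fin b := fun i => if h : (i : ℕ) < k then ⟨B ⟨i, h⟩, hB _⟩ else ⟨0, hb⟩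
  refine Finset.card_pos.2 ⟨wordEquiv b (f, 0), ?_⟩
  rw [Finset.mem_filter, Finset.mem_range]
  refine ⟨(wordEquiv b (f, 0)).2, ?_⟩
  rw [chunkMatch_wordEquiv]
  exact ⟨by simpa using hk, fun j => by simp [f]⟩

end Chunk

/-! ### Quotients of counting functions -/

section Counting

/-- If two predicates hold equally often, and at least once, in all late intervals
`[s r, s (r + 1))`, and at most `ℓ r = o(r)` times, then the quotient of their counting functions
tends to `1`. -/
theorem tendsto_count_div_count {p₁ p₂ : ℕ → Prop} [DecidablePred p₁] [DecidablePred p₂]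
    {s ℓ : ℕ → ℕ} (hs0 : s 0 = 0) (hs : StrictMono s) (r₀ : ℕ)
    (heq : ∀ r, r₀ ≤ r → Nat.count p₁ (s (r + 1)) + Nat.count p₂ (s r) =
      Nat.count p₂ (s (r + 1)) + Nat.count p₁ (s r))
    (hpos : ∀ r, r₀ ≤ r → Nat.count p₂ (s r) + 1 ≤ Nat.count p₂ (s (r + 1)))
    (hle : ∀ r, r₀ ≤ r → Nat.count p₂ (s (r + 1)) ≤ Nat.count p₂ (s r) + ℓ r)
    (hℓ : Tendsto (fun r => (ℓ r : ℝ) / r) atTop (𝓝 0)) :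
    Tendsto (fun n => (((Finset.Icc 1 n).filter p₁).card : ℝ) /
      (((Finset.Icc 1 n).filter p₂).card : ℝ)) atTop (𝓝 1) := by
  have hex : ∀ n, ∃ r, s r ≤ n + 1 ∧ n + 1 < s (r + 1) := by
    intro n
    have h : ∃ r, n + 1 < s (r + 1) := ⟨n + 1, by have := hs.id_le (n + 1 + 1); simp at this; omega⟩
    refine ⟨Nat.find h, ?_, Nat.find_spec h⟩
    rcases Nat.eq_zero_or_pos (Nat.find h) with h0 | h0
    · rw [h0, hs0]; omega
    · have := Nat.find_min h (m := Nat.find h - 1) (by omega)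
      rw [Nat.sub_add_cancel h0] at this
      omega
  choose ρ hρ1 hρ2 using hex
  have hρ : Tendsto ρ atTop atTop := by
    refine tendsto_atTop.2 fun R => ?_
    filter_upwards [eventually_ge_atTop (s R)] with n hn
    by_contra! h
    have := hs.monotone (show ρ n + 1 ≤ R by omega)
    have := hρ2 n
    omega
  -- `Nat.count` also looks at the position 0, which is not a digit position; this accounts for the
  -- error 1.
  have hcard : ∀ (p : ℕ → Prop) [DecidablePred p] n,
      ((Finset.Icc 1 n).filter p).card ≤ Nat.count p (n + 1) ∧
      Nat.count p (n + 1) ≤ ((Finset.Icc 1 n).filter p).card + 1 := by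
    intro p _ n
    rw [Nat.count_eq_card_filter_range, Finset.range_eq_Ico,
      ← Finset.insert_Ico_add_one_left_eq_Ico (by omega), Finset.filter_insert,
      show Finset.Ico (0 + 1) (n + 1) = Finset.Icc 1 n from rfl]
    split_ifs
    · exact ⟨Finset.card_le_card (Finset.subset_insert _ _), Finset.card_insert_le _ _⟩
    · exact ⟨le_rfl, Nat.le_succ _⟩
  set C := Nat.count p₁ (s r₀) + Nat.count p₂ (s r₀) with hC
  have hdiff : ∀ d, Nat.count p₁ (s (r₀ + d)) + Nat.count p₂ (s r₀) =
      Nat.count p₂ (s (r₀ + d)) + Nat.count p₁ (s r₀) := by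
    intro d
    induction d with
    | zero => rw [add_zero, add_comm]
    | succ d ih =>
      have := heq (r₀ + d) (by omega)
      rw [← add_assoc]
      omega
  have hgrow : ∀ d, d ≤ Nat.count p₂ (s (r₀ + d)) := by
    intro d
    induction d with
    | zero => omega
    | succ d ih =>
      have := hpos (r₀ + d) (by omega)
      rw [← add_assoc]
      omega
  -- The two counts differ by a constant at the ends of intervals and by at most `ℓ r` more within
  -- one. One occurrence per interval makes the denominator at least `r` minus a constant.
  have hbound : ∀ r n, r₀ ≤ r → s r ≤ n + 1 → n + 1 < s (r + 1) →
      ((Finset.Icc 1 n).filter p₁).card ≤ ((Finset.Icc 1 n).filter p₂).card + (C + ℓ r + 1) ∧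
      ((Finset.Icc 1 n).filter p₂).card ≤ ((Finset.Icc 1 n).filter p₁).card + (C + ℓ r + 1) ∧
      r ≤ ((Finset.Icc 1 n).filter p₂).card + (r₀ + 1) := by
    intro r n hr h1 h2
    obtain ⟨d, rfl⟩ := Nat.exists_eq_add_of_le hr
    have a1 := hcard p₁ n
    have a2 := hcard p₂ n
    have m1 := Nat.count_monotone p₁ h1
    have m2 := Nat.count_monotone p₂ h1
    have m3 := Nat.count_monotone p₁ h2.le
    have m4 := Nat.count_monotone p₂ h2.le
    have e1 := hdiff d
    have e2 := heq _ hr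
    have e3 := hle _ hr
    have e4 := hgrow d
    refine ⟨?_, ?_, ?_⟩ <;> omega
  have hg : Tendsto (fun r : ℕ => ((C + ℓ r + 1 : ℕ) : ℝ) / (r - (r₀ + 1 : ℕ) : ℝ))
      atTop (𝓝 0) := by
    have hinv : Tendsto (fun r : ℕ => (1 : ℝ) / r) atTop (𝓝 0) :=
      tendsto_one_div_atTop_nhds_zero_nat
    have hnum : Tendsto (fun r : ℕ => ((C + 1 : ℕ) : ℝ) * (1 / r) + (ℓ r : ℝ) / r)
        atTop (𝓝 0) := by simpa using (hinv.const_mul ((C + 1 : ℕ) : ℝ)).add hℓ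
    have hden : Tendsto (fun r : ℕ => 1 - ((r₀ + 1 : ℕ) : ℝ) * (1 / r)) atTop (𝓝 1) := by
      simpa using (hinv.const_mul ((r₀ + 1 : ℕ) : ℝ)).const_sub 1
    have := hnum.div hden one_ne_zero
    rw [zero_div] at this
    refine this.congr' ?_
    filter_upwards [eventually_gt_atTop (r₀ + 1)] with r hr
    have h1 : (0 : ℝ) < r := by exact_mod_cast (by omega : 0 < r)
    have h2 : (0 : ℝ) < r - (r₀ + 1 : ℕ) := sub_pos.2 (by exact_mod_cast hr)
    simp only [Pi.div_apply]
    have h3 : 1 - ((r₀ + 1 : ℕ) : ℝ) * (1 / r) = (r - (r₀ + 1 : ℕ)) / r := by field_simp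
    rw [h3]
    push_cast at h2 ⊢
    field_simp
    ring
  rw [tendsto_iff_norm_sub_tendsto_zero]
  refine squeeze_zero' (Eventually.of_forall fun _ => norm_nonneg _) ?_ (hg.comp hρ)
  filter_upwards [hρ.eventually_gt_atTop (r₀ + 1)] with n hn
  obtain ⟨b1, b2, b3⟩ := hbound (ρ n) n (by omega) (hρ1 n) (hρ2 n)
  set x := ((Finset.Icc 1 n).filter p₁).card
  set y := ((Finset.Icc 1 n).filter p₂).card
  have c1 : (x : ℝ) ≤ y + (C + ℓ (ρ n) + 1 : ℕ) := by exact_mod_cast b1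
  have c2 : (y : ℝ) ≤ x + (C + ℓ (ρ n) + 1 : ℕ) := by exact_mod_cast b2
  have c3 : (ρ n : ℝ) ≤ y + (r₀ + 1 : ℕ) := by exact_mod_cast b3
  have c4 : (0 : ℝ) < ρ n - (r₀ + 1 : ℕ) := sub_pos.2 (by exact_mod_cast hn)
  have hy : (0 : ℝ) < y := by linarith
  rw [Function.comp_apply, Real.norm_eq_abs, div_sub_one hy.ne', abs_div, abs_of_pos hy]
  refine div_le_div₀ (Nat.cast_nonneg _) (abs_sub_le_iff.2 ⟨by linarith, by linarith⟩) c4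
    (by linarith)

end Counting

/-! ### Uniform distribution of an explicit sequence and its perturbations -/

section Uniform

/-- The sequence `0, 0, 1/3, 2/3, 0, 1/5, 2/5, …`, which lists the multiples of `1 / (2 m + 1)` in
`[0, 1)` for `m = 0, 1, …`. -/
noncomputable def squareFrac (n : ℕ) : ℝ :=
  ((n - Nat.sqrt n ^ 2 : ℕ) : ℝ) / (2 * Nat.sqrt n + 1 : ℕ)

theorem squareFrac_nonneg (n : ℕ) : 0 ≤ squareFrac n := by unfold squareFrac; positivity

theorem sub_sqrt_sq_lt (n : ℕ) : n - Nat.sqrt n ^ 2 < 2 * Nat.sqrt n + 1 := by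
  have := Nat.sqrt_le_add n
  rw [pow_two]
  omega

theorem squareFrac_lt_one (n : ℕ) : squareFrac n < 1 := by
  rw [squareFrac, div_lt_one (by positivity)]
  exact_mod_cast sub_sqrt_sq_lt n

theorem squareFrac_sq_add {m i : ℕ} (hi : i < 2 * m + 1) :
    squareFrac (m ^ 2 + i) = (i : ℝ) / (2 * m + 1 : ℕ) := by
  have : Nat.sqrt (m ^ 2 + i) = m := by
    rw [pow_two]
    exact Nat.sqrt_add_eq m (by omega)
  rw [squareFrac, this, Nat.add_sub_cancel_left]

theorem count_squareFrac_lt_block {c : ℝ} (h1 : c ≤ 1) (m : ℕ) :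
    Nat.count (fun i => squareFrac (m ^ 2 + i) < c) (2 * m + 1) = ⌈c * (2 * m + 1 : ℕ)⌉₊ := by
  have hM : (0 : ℝ) < (2 * m + 1 : ℕ) := by positivity
  have hle : ⌈c * (2 * m + 1 : ℕ)⌉₊ ≤ 2 * m + 1 := by
    rw [Nat.ceil_le]
    nlinarith
  rw [Nat.count_eq_card_filter_range]
  have : (Finset.range (2 * m + 1)).filter (fun i => squareFrac (m ^ 2 + i) < c) =
      Finset.range ⌈c * (2 * m + 1 : ℕ)⌉₊ := by
    ext i
    rw [Finset.mem_filter, Finset.mem_range, Finset.mem_range, Nat.lt_ceil]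
    constructor
    · rintro ⟨hi, h⟩
      rwa [squareFrac_sq_add hi, div_lt_iff₀ hM] at h
    · intro h
      have hi : i < 2 * m + 1 := (Nat.lt_ceil.2 h).trans_le hle
      exact ⟨hi, by rwa [squareFrac_sq_add hi, div_lt_iff₀ hM]⟩
  rw [this, Finset.card_range]

/-- Between consecutive squares the exact count is a ceiling, which exceeds its expected value by
less than 1; these errors add up over `m` blocks. -/
theorem count_squareFrac_lt_sq {c : ℝ} (h0 : 0 ≤ c) (h1 : c ≤ 1) (m : ℕ) :
    c * (m ^ 2 : ℕ) ≤ Nat.count (fun n => squareFrac n < c) (m ^ 2) ∧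
      Nat.count (fun n => squareFrac n < c) (m ^ 2) ≤ c * (m ^ 2 : ℕ) + m := by
  induction m with
  | zero => simp
  | succ m ih =>
    have hM : 0 ≤ c * (2 * m + 1 : ℕ) := by positivity
    rw [show (m + 1) ^ 2 = m ^ 2 + (2 * m + 1) by ring, Nat.count_add,
      count_squareFrac_lt_block h1]
    have hc1 := Nat.le_ceil (c * (2 * m + 1 : ℕ))
    have hc2 := Nat.ceil_lt_add_one hM
    rw [Nat.cast_add, Nat.cast_add, mul_add]
    push_cast at *
    constructor <;> linarith [ih.1, ih.2]

theorem abs_count_squareFrac_lt_sub_le {c : ℝ} (h0 : 0 ≤ c) (h1 : c ≤ 1) (N : ℕ) :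
    |(Nat.count (fun n => squareFrac n < c) N : ℝ) - c * N| ≤ 3 * √N + 2 := by
  set m := Nat.sqrt N with hm
  have hlo : m ^ 2 ≤ N := Nat.sqrt_le' N
  have hhi : N ≤ (m + 1) ^ 2 := (Nat.lt_succ_sqrt' N).le
  have hN : N ≤ m ^ 2 + 2 * m := by
    have := Nat.sqrt_le_add N
    rw [← hm] at this
    rw [pow_two]
    omega
  have hms : (m : ℝ) ≤ √N := Real.nat_sqrt_le_real_sqrt
  obtain ⟨b1, -⟩ := count_squareFrac_lt_sq h0 h1 m
  obtain ⟨-, b2⟩ := count_squareFrac_lt_sq h0 h1 (m + 1)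
  have c1 : (Nat.count (fun n => squareFrac n < c) (m ^ 2) : ℝ) ≤
      Nat.count (fun n => squareFrac n < c) N := by exact_mod_cast Nat.count_monotone _ hlo
  have c2 : (Nat.count (fun n => squareFrac n < c) N : ℝ) ≤
      Nat.count (fun n => squareFrac n < c) ((m + 1) ^ 2) := by
    exact_mod_cast Nat.count_monotone _ hhi
  have d1 : (N : ℝ) ≤ m ^ 2 + 2 * m := by exact_mod_cast hN
  have d2 : (m : ℝ) ^ 2 ≤ N := by exact_mod_cast hlo
  have hm0 : (0 : ℝ) ≤ m := Nat.cast_nonneg _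
  push_cast at b1 b2
  rw [abs_sub_le_iff]
  constructor
  · nlinarith [mul_le_mul_of_nonneg_left d2 h0, mul_le_mul_of_nonneg_right h1 hm0]
  · nlinarith [mul_le_mul_of_nonneg_left d1 h0, mul_le_mul_of_nonneg_right h1 hm0]

theorem tendsto_sqrt_div_self :
    Tendsto (fun N : ℕ => (3 * √(N : ℝ) + 2) / N) atTop (𝓝 0) := by
  have h : Tendsto (fun N : ℕ => (√(N : ℝ))⁻¹) atTop (𝓝 0) :=
    (Real.tendsto_sqrt_atTop.comp tendsto_natCast_atTop_atTop).inv_tendsto_atTop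
  have hs := (h.const_mul 3).add (tendsto_one_div_atTop_nhds_zero_nat.const_mul (2 : ℝ))
  simp only [mul_zero, add_zero] at hs
  refine hs.congr fun N => ?_
  rw [← one_div, ← Real.sqrt_div_self']
  ring

theorem tendsto_count_squareFrac_lt {c : ℝ} (h0 : 0 ≤ c) (h1 : c ≤ 1) :
    Tendsto (fun N : ℕ => (Nat.count (fun n => squareFrac n < c) N : ℝ) / N) atTop (𝓝 c) := by
  rw [tendsto_iff_norm_sub_tendsto_zero]
  refine squeeze_zero' (Eventually.of_forall fun _ => norm_nonneg _) ?_ tendsto_sqrt_div_self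
  filter_upwards [eventually_gt_atTop 0] with N hN
  have hN' : (0 : ℝ) < N := by exact_mod_cast hN
  rw [Real.norm_eq_abs, div_sub' hN'.ne', abs_div, abs_of_pos hN', mul_comm (N : ℝ)]
  gcongr
  exact abs_count_squareFrac_lt_sub_le h0 h1 N

theorem count_le_count_add_count {p r s : ℕ → Prop} [DecidablePred p] [DecidablePred r]
    [DecidablePred s] (h : ∀ n, p n → r n ∨ s n) (N : ℕ) :
    Nat.count p N ≤ Nat.count r N + Nat.count s N := by
  simp only [Nat.count_eq_card_filter_range]
  refine (Finset.card_le_card ?_).trans (Finset.card_union_le _ _)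
  intro n
  simp only [Finset.mem_filter, Finset.mem_union]
  rintro ⟨h1, h2⟩
  exact (h n h2).imp (⟨h1, ·⟩) (⟨h1, ·⟩)

open Classical in
/-- Uniform distribution is not affected by a perturbation that is small outside of a set of
density zero. -/
theorem tendsto_count_lt_of_close {y z : ℕ → ℝ} (hy0 : ∀ n, 0 ≤ y n) (hy1 : ∀ n, y n < 1)
    (hy : ∀ c : ℝ, 0 ≤ c → c ≤ 1 →
      Tendsto (fun N : ℕ => (Nat.count (fun n => y n < c) N : ℝ) / N) atTop (𝓝 c))
    (hyz : ∀ ε : ℝ, 0 < ε →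
      Tendsto (fun N : ℕ => (Nat.count (fun n => ε < |z n - y n|) N : ℝ) / N) atTop (𝓝 0))
    {c : ℝ} (h0 : 0 ≤ c) (h1 : c ≤ 1) :
    Tendsto (fun N : ℕ => (Nat.count (fun n => z n < c) N : ℝ) / N) atTop (𝓝 c) := by
  rw [Metric.tendsto_atTop']
  intro ε hε
  set δ := ε / 3 with hδ
  have hδ0 : 0 < δ := by positivity
  -- The shifted thresholds are clipped to the unit interval, where `hy` applies. The three parts of
  -- `ε` pay for the shift, for the convergence and for the exceptional set.
  have hup := (hy (min (c + δ) 1) (le_min (by linarith) zero_le_one) (min_le_right _ _)).eventually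
    (gt_mem_nhds (show min (c + δ) 1 < c + δ + δ by linarith [min_le_left (c + δ) 1]))
  have hlo := (hy (max (c - δ) 0) (le_max_right _ _) (max_le (by linarith) zero_le_one)).eventually
    (lt_mem_nhds (show c - δ - δ < max (c - δ) 0 by linarith [le_max_left (c - δ) 0]))
  have hbad := (hyz (δ / 2) (by positivity)).eventually (gt_mem_nhds hδ0)
  obtain ⟨M, hM⟩ := eventually_atTop.1 (hup.and (hlo.and (hbad.and (eventually_gt_atTop 0))))
  refine ⟨M, fun N hN => ?_⟩
  obtain ⟨e1, e2, e3, e4⟩ := hM N hN.le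
  have hN' : (0 : ℝ) < N := by exact_mod_cast e4
  have u1 : Nat.count (fun n => z n < c) N ≤ Nat.count (fun n => y n < min (c + δ) 1) N +
      Nat.count (fun n => δ / 2 < |z n - y n|) N := by
    refine count_le_count_add_count (fun n hn => ?_) N
    by_cases hb : δ / 2 < |z n - y n|
    · exact Or.inr hb
    · have := abs_le.1 (not_lt.1 hb)
      exact Or.inl (lt_min (by linarith [this.1]) (hy1 n))
  have u2 : Nat.count (fun n => y n < max (c - δ) 0) N ≤ Nat.count (fun n => z n < c) N +
      Nat.count (fun n => δ / 2 < |z n - y n|) N := by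
    refine count_le_count_add_count (fun n hn => ?_) N
    by_cases hb : δ / 2 < |z n - y n|
    · exact Or.inr hb
    · have := abs_le.1 (not_lt.1 hb)
      rcases lt_max_iff.1 hn with h | h
      · exact Or.inl (by linarith [this.2])
      · exact absurd h (not_lt.2 (hy0 n))
  have v1 : (Nat.count (fun n => z n < c) N : ℝ) / N ≤
      (Nat.count (fun n => y n < min (c + δ) 1) N : ℝ) / N +
      (Nat.count (fun n => δ / 2 < |z n - y n|) N : ℝ) / N := by
    rw [← add_div]; gcongr; exact_mod_cast u1
  have v2 : (Nat.count (fun n => y n < max (c - δ) 0) N : ℝ) / N ≤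
      (Nat.count (fun n => z n < c) N : ℝ) / N +
      (Nat.count (fun n => δ / 2 < |z n - y n|) N : ℝ) / N := by
    rw [← add_div]; gcongr; exact_mod_cast u2
  rw [Real.dist_eq, abs_sub_lt_iff]
  constructor <;> linarith

theorem uniformlyDistributedMod1_of_tendsto_count {z : ℕ → ℝ} (hz0 : ∀ n, 0 ≤ z n)
    (hz1 : ∀ n, z n < 1) (hz : ∀ c : ℝ, 0 ≤ c → c ≤ 1 →
      Tendsto (fun N : ℕ => (Nat.count (fun n => z n < c) N : ℝ) / N) atTop (𝓝 c)) :
    UniformlyDistributedMod1 z := by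
  intro a b ha hab hb
  refine ((hz b (ha.trans hab) hb).sub (hz a ha (hab.trans hb))).congr fun N => ?_
  rw [← sub_div]
  congr 1
  rw [sub_eq_iff_eq_add, ← Nat.cast_add, Nat.cast_inj]
  simp only [Nat.count_eq_card_filter_range, Int.fract_eq_self.2 ⟨hz0 _, hz1 _⟩]
  rw [← Finset.card_union_of_disjoint]
  · congr 1
    ext n
    simp only [Finset.mem_filter, Finset.mem_union]
    constructor
    · rintro ⟨h1, h2⟩
      rcases le_or_gt a (z n) with h | h
      · exact Or.inl ⟨h1, h, h2⟩
      · exact Or.inr ⟨h1, h⟩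
    · rintro (⟨h1, -, h2⟩ | ⟨h1, h2⟩)
      · exact ⟨h1, h2⟩
      · exact ⟨h1, h2.trans_le hab⟩
  · rw [Finset.disjoint_left]
    simp only [Finset.mem_filter, not_and, not_lt]
    rintro n ⟨-, h, -⟩ -
    exact h

end Uniform

/-! ### The constructed number and its normality properties -/

section Construction

variable {q : ℕ → ℕ}

/-- With numerators `q_1 ⋯ q_{m-1}` the terms of the Cantor sum are `1 / q_m`, so integer division
computes the floor of the harmonic sum exactly. -/
theorem harmonicFloor_eq (hq : IsBasic q) (n : ℕ) :
    harmonicFloor q n = ⌊∑ i ∈ Finset.Icc 1 n, (1 : ℝ) / q i⌋₊ := by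
  rw [harmonicFloor, ← Nat.floor_div_eq_div (K := ℝ), cantorNum_div_prodQ hq]
  congr 1
  refine Finset.sum_congr rfl fun i hi => ?_
  obtain ⟨m, rfl⟩ : ∃ m, i = m + 1 := ⟨i - 1, by have := (Finset.mem_Icc.1 hi).1; omega⟩
  have h1 : (prodQ q m : ℝ) ≠ 0 := by exact_mod_cast (prodQ_pos hq m).ne'
  rw [Nat.add_sub_cancel, prodQ]
  push_cast
  rw [div_mul_eq_div_div, div_self h1]

theorem harmonicFloor_le (hq : IsBasic q) (n : ℕ) :
    (harmonicFloor q n : ℝ) ≤ ∑ i ∈ Finset.Icc 1 n, (1 : ℝ) / q i := by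
  rw [harmonicFloor_eq hq]
  exact Nat.floor_le (Finset.sum_nonneg fun _ _ => by positivity)

theorem harmonicFloor_monotone (hq : IsBasic q) : Monotone (harmonicFloor q) := by
  intro m n h
  rw [harmonicFloor_eq hq, harmonicFloor_eq hq]
  exact Nat.floor_le_floor (Finset.sum_le_sum_of_subset_of_nonneg
    (Finset.Icc_subset_Icc_right h) fun _ _ _ => by positivity)

theorem expectedCount_zero_block (hq : IsBasic q) (n : ℕ) :
    expectedCount q (fun _ : Fin 1 => 0) n = ∑ i ∈ Finset.Icc 1 n, (1 : ℝ) / q i := by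
  refine Finset.sum_congr rfl fun i hi => ?_
  have := hq i (Finset.mem_Icc.1 hi).1
  simp [show 0 < q i by omega]

/-- The factors of the denominator other than `q i` are at least 1. Hence divergence for any one
block forces `∑ 1 / q i = ∞`. -/
theorem expectedCount_le (hq : IsBasic q) {k : ℕ} (hk : 1 ≤ k) (B : Fin k → ℕ) (n : ℕ) :
    expectedCount q B n ≤ ∑ i ∈ Finset.Icc 1 n, (1 : ℝ) / q i := by
  refine Finset.sum_le_sum fun i hi => ?_
  have hi1 := (Finset.mem_Icc.1 hi).1
  have h2 : ∀ j : ℕ, (1 : ℝ) ≤ q (i + j) := fun j => by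
    have := hq (i + j) (by omega)
    exact_mod_cast (by omega : 1 ≤ q (i + j))
  have hq0 : (0 : ℝ) < q i := zero_lt_one.trans_le (h2 0)
  have hprod : (q i : ℝ) ≤ ∏ j : Fin k, (q (i + j) : ℝ) := by
    obtain ⟨k, rfl⟩ : ∃ m, k = m + 1 := ⟨k - 1, by omega⟩
    rw [Fin.prod_univ_succ]
    exact le_mul_of_one_le_right hq0.le
      (Finset.prod_induction _ (fun x : ℝ => 1 ≤ x) (fun _ _ => one_le_mul_of_one_le_of_one_le)
        le_rfl fun j _ => h2 _)
  refine div_le_div₀ zero_le_one ?_ hq0 hprod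
  split_ifs <;> norm_num

theorem tendsto_sum_inv (hq : IsBasic q)
    (hdiv : ∃ k : ℕ, 1 ≤ k ∧ ∃ B : Fin k → ℕ, BlockDivergent q B) :
    Tendsto (fun n => ∑ i ∈ Finset.Icc 1 n, (1 : ℝ) / q i) atTop atTop := by
  obtain ⟨k, hk, B, hB⟩ := hdiv
  exact tendsto_atTop_mono (expectedCount_le hq hk B) hB

theorem tendsto_harmonicFloor (hq : IsBasic q)
    (h : Tendsto (fun n => ∑ i ∈ Finset.Icc 1 n, (1 : ℝ) / q i) atTop atTop) :
    Tendsto (harmonicFloor q) atTop atTop := by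
  rw [show harmonicFloor q = _ from funext (harmonicFloor_eq hq)]
  exact tendsto_nat_floor_atTop.comp h

/-- The sequence `L` is a modulus for the convergence of `q` to infinity. -/
theorem lt_of_L_le (hlim : Tendsto q atTop atTop) {b n : ℕ} (hb : b ≠ 0) (hn : L q b ≤ n) :
    b < q n := by
  obtain ⟨b, rfl⟩ : ∃ m, b = m + 1 := ⟨b - 1, by omega⟩
  have hne : {t : ℕ | 1 ≤ t ∧ ∀ j, t ≤ j → ((b + 1 : ℕ) : ℝ) < Real.log (q j)}.Nonempty := by
    have ht : Tendsto (fun j => Real.log (q j)) atTop atTop :=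
      Real.tendsto_log_atTop.comp (tendsto_natCast_atTop_atTop.comp hlim)
    obtain ⟨t, ht⟩ := eventually_atTop.1 (ht.eventually_gt_atTop ((b + 1 : ℕ) : ℝ))
    exact ⟨t + 1, by omega, fun j hj => ht j (by omega)⟩
  have hle : logThreshold q (b + 1) ≤ n := by
    rw [L] at hn
    exact (le_max_left _ _).trans ((le_max_left _ _).trans hn)
  have := (Nat.sInf_mem hne).2 n hle
  have hlog := Real.log_le_self (Nat.cast_nonneg (α := ℝ) (q n))
  exact_mod_cast this.trans_le hlog

/-- A level costs the length of its chunk times the level, so that chunks are short when compared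
with their index, and at least as much as the value of the modulus `L`. -/
noncomputable def cost (q : ℕ → ℕ) (b : ℕ) : ℕ := chunkLen b * b + L q b

/-- The digits of the number to be constructed. -/
noncomputable def goodDigit (q : ℕ → ℕ) : ℕ → ℕ :=
  mixedDigit q (level (cost q)) (harmonicFloor q)

/-- The position `n` carries a digit of a chunk. -/
def InsertedAt (q : ℕ → ℕ) (n : ℕ) : Prop :=
  IsInserted (level (cost q) (state (level (cost q)) (harmonicFloor q) n).1)
    (state (level (cost q)) (harmonicFloor q) n).2

noncomputable instance (q : ℕ → ℕ) (n : ℕ) : Decidable (InsertedAt q n) :=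
  inferInstanceAs (Decidable (IsInserted _ _))

theorem computable_goodDigit (hq : Computable q) (hL : Computable (L q)) :
    Computable (goodDigit q) :=
  computable_mixedDigit hq
    (computable_level (computable_add
      (computable_mul (computable_chunkLen Computable.id) Computable.id) hL))
    (computable_harmonicFloor hq)

theorem cost_zero (q : ℕ → ℕ) : cost q 0 = 0 := by simp [cost, chunkLen, L]

theorem goodDigit_of_not_inserted {n : ℕ} (h : ¬ InsertedAt q n) :
    goodDigit q n = spreadDigit q n := if_neg h

/-- A chunk of level `b` has index at least `cost q b ≥ L q b`, and the index of a chunk never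
exceeds the position. So the modulus gives `b < q n`, while inserted digits are below `b`. -/
theorem goodDigit_succ_lt_of_inserted (hlim : Tendsto q atTop atTop) {n : ℕ}
    (h : InsertedAt q n) : goodDigit q n + 1 < q n := by
  set b := level (cost q) (state (level (cost q)) (harmonicFloor q) n).1 with hb
  have hb0 : 0 < b := (Nat.zero_le _).trans_lt h.2
  have hlt : goodDigit q n < b := by
    rw [goodDigit, mixedDigit, if_pos (show IsInserted _ _ from h)]
    exact Nat.mod_lt _ hb0
  have hc := cost_level_le (cost_zero q) (state (level (cost q)) (harmonicFloor q) n).1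
  rw [← hb, cost] at hc
  have := state_fst_le (level (cost q)) (harmonicFloor q) n
  have := lt_of_L_le hlim hb0.ne' (show L q b ≤ n by omega)
  omega

theorem spreadDigit_lt (n : ℕ) (h : 2 ≤ q n) : spreadDigit q n < q n := by
  refine max_lt (Nat.sqrt_lt_self (by omega)) ?_
  refine lt_of_le_of_lt (Nat.div_le_of_le_mul ?_) (show q n - 1 < q n by omega)
  rw [mul_comm]
  exact Nat.mul_le_mul_right _ (sub_sqrt_sq_lt _).le

theorem spreadDigit_succ_lt (n : ℕ) (h : 4 ≤ q n) : spreadDigit q n + 1 < q n := by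
  suffices spreadDigit q n < q n - 1 by omega
  refine max_lt ?_ (Nat.div_lt_of_lt_mul ?_)
  · rw [Nat.sqrt_lt]
    obtain ⟨m, hm⟩ := Nat.exists_eq_add_of_le h
    rw [hm, show 4 + m - 1 = 3 + m by omega]
    nlinarith
  · rw [mul_comm]
    exact Nat.mul_lt_mul_of_pos_right (sub_sqrt_sq_lt _) (by omega)

theorem tendsto_spreadDigit (hlim : Tendsto q atTop atTop) :
    Tendsto (spreadDigit q) atTop atTop := by
  refine tendsto_atTop.2 fun b => ?_
  filter_upwards [hlim.eventually_ge_atTop (b * b)] with n hn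
  exact (Nat.le_sqrt.2 hn).trans (le_max_left _ _)

theorem goodDigit_lt (hq : IsBasic q) (hlim : Tendsto q atTop atTop) (n : ℕ) (hn : 1 ≤ n) :
    goodDigit q n < q n := by
  by_cases h : InsertedAt q n
  · exact (Nat.lt_succ_self _).trans (goodDigit_succ_lt_of_inserted hlim h)
  · rw [goodDigit_of_not_inserted h]
    exact spreadDigit_lt n (hq n hn)

theorem exists_goodDigit_succ_lt (hlim : Tendsto q atTop atTop) (m : ℕ) :
    ∃ n, m ≤ n ∧ goodDigit q (n + 1) + 1 < q (n + 1) := by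
  obtain ⟨M, hM⟩ := eventually_atTop.1 (hlim.eventually_ge_atTop 4)
  refine ⟨m + M, by omega, ?_⟩
  by_cases h : InsertedAt q (m + M + 1)
  · exact goodDigit_succ_lt_of_inserted hlim h
  · rw [goodDigit_of_not_inserted h]
    exact spreadDigit_succ_lt _ (hM _ (by omega))

theorem card_insertedAt_le (hq : IsBasic q) (n : ℕ) :
    (((Finset.Icc 1 n).filter (InsertedAt q)).card : ℝ) ≤
      (∑ i ∈ Finset.Icc 1 n, (1 : ℝ) / q i) / 2 + totalLen (level (cost q)) 1 := by
  have h1 : ((Finset.Icc 1 n).filter (InsertedAt q)).card ≤ _ :=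
    card_inserted_le_totalLen (level (cost q)) (harmonicFloor q) n
  have h2 := two_mul_totalLen_le (β := level (cost q)) (harmonicFloor_monotone hq) n
  have h3 := harmonicFloor_le hq n
  have h4 : 2 * (((Finset.Icc 1 n).filter (InsertedAt q)).card : ℝ) ≤
      harmonicFloor q n + 2 * totalLen (level (cost q)) 1 := by
    exact_mod_cast (Nat.mul_le_mul_left 2 h1).trans h2
  linarith

/-- The summand `chunkLen b * b` of the cost bounds the quotient by the reciprocal of the level. -/
theorem tendsto_chunkLen_div (q : ℕ → ℕ) :
    Tendsto (fun r => (chunkLen (level (cost q) r) : ℝ) / r) atTop (𝓝 0) := by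
  have hβ := tendsto_level (cost q)
  refine squeeze_zero' (Eventually.of_forall fun _ => by positivity) ?_
    (tendsto_one_div_atTop_nhds_zero_nat.comp hβ)
  filter_upwards [hβ.eventually_gt_atTop 0, eventually_gt_atTop 0] with r h1 h2
  have hc := cost_level_le (cost_zero q) r
  rw [cost] at hc
  rw [Function.comp_apply, div_le_div_iff₀ (by exact_mod_cast h2) (by exact_mod_cast h1), one_mul]
  exact_mod_cast (Nat.le_add_right _ _).trans hc

/-- Occurrences of a block in the digits, starting in a late chunk, are occurrences in the words
of this chunk. -/
theorem occurrence_iff {β F : ℕ → ℕ} {k r n n' t : ℕ} (hk : 1 ≤ k) {B : Fin k → ℕ}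
    (hn : n + chunkLen (β r) ≤ n')
    (hst : ∀ t, n + t < n' → state β F (n + t) = (r, t))
    (hB : ∀ m, n ≤ m → ∀ j, B j < spreadDigit q m) (ht : n + t < n') :
    (∀ j : Fin k, mixedDigit q β F (n + t + j) = B j) ↔
      t < chunkLen (β r) ∧ ChunkMatch (β r) B t := by
  -- Spread digits from `n` on are larger than all entries of `B`, so an occurrence can use inserted
  -- digits only.
  have hins : ∀ u, n + u < n' → ∀ j : Fin k, mixedDigit q β F (n + u) = B j →
      IsInserted (β r) u := by
    intro u hu j h
    by_contra hni
    rw [mixedDigit, hst u hu, if_neg hni] at h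
    exact (hB (n + u) (by omega) j).ne' h
  have hdig : ∀ u, u < chunkLen (β r) → u % (β r + 1) < β r →
      mixedDigit q β F (n + u) = chunkDigit (β r) u := by
    intro u h1 h2
    rw [mixedDigit, hst u (by omega), if_pos ⟨h1, h2⟩]
  have hword : t < chunkLen (β r) → t % (β r + 1) + k ≤ β r → ∀ j : Fin k,
      mixedDigit q β F (n + t + j) =
        t / (β r + 1) / β r ^ (t % (β r + 1) + j) % β r := by
    intro h1 h2 j
    have hj := j.2
    have ho := chunkDigit_offset (b := β r) (t := t) (j := j) (by omega)
    have hl := add_lt_chunkLen (j := j) h1 (by omega)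
    rw [add_assoc, hdig _ hl (by omega), chunkDigit, ho.1, ho.2]
  constructor
  · intro h
    obtain ⟨h1, h2⟩ := hins t ht ⟨0, hk⟩ (h ⟨0, hk⟩)
    have h3 : t % (β r + 1) + k ≤ β r := by
      -- An occurrence running past the end of its word would cover the separator, at remainder `β
      -- r` modulo `β r + 1`, which is not inserted.
      by_contra hlt
      have hj : t % (β r + 1) + (β r - t % (β r + 1)) ≤ β r := by omega
      have ho := (chunkDigit_offset hj).2
      have hl := add_lt_chunkLen h1 hj
      have := h ⟨β r - t % (β r + 1), by omega⟩
      rw [add_assoc] at this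
      have := (hins _ (show n + (t + (β r - t % (β r + 1))) < n' by omega) _ this).2
      omega
    exact ⟨h1, h3, fun j => (hword h1 h3 j).symm.trans (h j)⟩
  · rintro ⟨h1, h3, h4⟩ j
    exact (hword h1 h3 j).trans (h4 j)

theorem count_occurrence {p : ℕ → Prop} [DecidablePred p] {b k n n' : ℕ} {B : Fin k → ℕ}
    (hn : n + chunkLen b ≤ n')
    (h : ∀ t, n + t < n' → (p (n + t) ↔ t < chunkLen b ∧ ChunkMatch b B t)) :
    Nat.count p n' =
      Nat.count p n + ((Finset.range (chunkLen b)).filter (ChunkMatch b B)).card := by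
  obtain ⟨d, rfl⟩ := Nat.exists_eq_add_of_le (show n ≤ n' by omega)
  rw [Nat.count_add, Nat.count_eq_card_filter_range (fun t => p (n + t))]
  congr 2
  ext t
  simp only [Finset.mem_filter, Finset.mem_range]
  constructor
  · rintro ⟨h1, h2⟩
    exact (h t (by omega)).1 h2
  · rintro ⟨h1, h2⟩
    exact ⟨by omega, (h t (by omega)).2 ⟨h1, h2⟩⟩

theorem isRatioNormal_of_digits (hlim : Tendsto q atTop atTop)
    (hF : Tendsto (harmonicFloor q) atTop atTop) {x : ℝ}
    (hx : ∀ n, 1 ≤ n → digit q x n = goodDigit q n) : IsRatioNormal q x := by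
  classical
  intro k hk B₁ B₂ _ _
  obtain ⟨s, hs0, hs, hlen, hst⟩ := exists_chunk_starts hF (level (cost q))
  have hb : ∃ b, ∀ j, B₁ j < b ∧ B₂ j < b := by
    refine ⟨(∑ j, B₁ j) + (∑ j, B₂ j) + 1, fun j => ?_⟩
    have h1 := Finset.single_le_sum (f := B₁) (fun _ _ => Nat.zero_le _) (Finset.mem_univ j)
    have h2 := Finset.single_le_sum (f := B₂) (fun _ _ => Nat.zero_le _) (Finset.mem_univ j)
    omega
  obtain ⟨b, hb⟩ := hb
  obtain ⟨n₀, hn₀⟩ := eventually_atTop.1 ((tendsto_spreadDigit hlim).eventually_ge_atTop b)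
  -- From this level on, the words are long enough for blocks of length `k` and their alphabet
  -- contains all entries of both blocks.
  obtain ⟨r₁, hr₁⟩ := eventually_atTop.1
    ((tendsto_level (cost q)).eventually_ge_atTop (b + k + 1))
  have hcount : ∀ B : Fin k → ℕ, (∀ j, B j < b) → ∀ r, n₀ + r₁ ≤ r →
      Nat.count (fun i => ∀ j : Fin k, goodDigit q (i + j) = B j) (s (r + 1)) =
      Nat.count (fun i => ∀ j : Fin k, goodDigit q (i + j) = B j) (s r) +
        ((Finset.range (chunkLen (level (cost q) r))).filter
          (ChunkMatch (level (cost q) r) B)).card := by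
    intro B hB r hr
    refine count_occurrence (hlen r) fun t ht => ?_
    refine occurrence_iff hk (hlen r) (hst r) (fun m hm j => ?_) ht
    have : r ≤ s r := hs.id_le r
    exact (hB j).trans_le (hn₀ m (by omega))
  have hBlt : ∀ r, n₀ + r₁ ≤ r → b + k + 1 ≤ level (cost q) r := fun r hr => hr₁ r (by omega)
  have hmain := tendsto_count_div_count
    (p₁ := fun i => ∀ j : Fin k, goodDigit q (i + j) = B₁ j)
    (p₂ := fun i => ∀ j : Fin k, goodDigit q (i + j) = B₂ j)
    (ℓ := fun r => chunkLen (level (cost q) r)) hs0 hs (n₀ + r₁)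
    (fun r hr => by
      have := hBlt r hr
      rw [hcount B₁ (fun j => (hb j).1) r hr, hcount B₂ (fun j => (hb j).2) r hr,
        card_chunkMatch_eq B₁ B₂ (fun j => by have := (hb j).1; omega)
          (fun j => by have := (hb j).2; omega)]
      omega)
    (fun r hr => by
      have := hBlt r hr
      rw [hcount B₂ (fun j => (hb j).2) r hr]
      have := card_chunkMatch_pos B₂ (b := level (cost q) r)
        (fun j => by have := (hb j).2; omega) (by omega) (by omega)
      omega)
    (fun r hr => by
      rw [hcount B₂ (fun j => (hb j).2) r hr]
      have := Finset.card_filter_le (Finset.range (chunkLen (level (cost q) r)))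
        (ChunkMatch (level (cost q) r) B₂)
      rw [Finset.card_range] at this
      omega)
    (tendsto_chunkLen_div q)
  have hbc : ∀ (B : Fin k → ℕ) n, blockCount q B x n =
      ((Finset.Icc 1 n).filter fun i => ∀ j : Fin k, goodDigit q (i + j) = B j).card := by
    intro B n
    rw [blockCount]
    congr 1
    refine Finset.filter_congr fun i hi => forall_congr' fun j => ?_
    rw [hx _ (by have := (Finset.mem_Icc.1 hi).1; omega)]
  simpa only [hbc] using hmain

theorem not_isNormal_of_digits (hq : IsBasic q) (hlim : Tendsto q atTop atTop)
    (hsum : Tendsto (fun n => ∑ i ∈ Finset.Icc 1 n, (1 : ℝ) / q i) atTop atTop) {x : ℝ}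
    (hx : ∀ n, 1 ≤ n → digit q x n = goodDigit q n) : ¬ IsNormal q x := by
  intro hnorm
  have heq : expectedCount q (fun _ : Fin 1 => 0) =
      fun n => ∑ i ∈ Finset.Icc 1 n, (1 : ℝ) / q i := funext (expectedCount_zero_block hq)
  have h := hnorm 1 le_rfl (fun _ => 0) (by rw [BlockDivergent, heq]; exact hsum)
  rw [heq] at h
  obtain ⟨n₀, hn₀⟩ := eventually_atTop.1 ((tendsto_spreadDigit hlim).eventually_gt_atTop 0)
  have hcount : ∀ n, (blockCount q (fun _ : Fin 1 => 0) x n : ℝ) ≤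
      (∑ i ∈ Finset.Icc 1 n, (1 : ℝ) / q i) / 2 +
        (totalLen (level (cost q)) 1 + n₀) := by
    intro n
    -- Beyond `n₀` spread digits are positive, so a zero is an inserted digit.
    have hsub : (Finset.Icc 1 n).filter (fun i => ∀ j : Fin 1, digit q x (i + j) = 0) ⊆
        (Finset.Icc 1 n).filter (InsertedAt q) ∪ Finset.range n₀ := by
      intro i hi
      rw [Finset.mem_filter] at hi
      rw [Finset.mem_union, Finset.mem_filter, Finset.mem_range]
      by_contra! hc
      have h0 := hi.2 0
      rw [Fin.val_zero, add_zero, hx i (Finset.mem_Icc.1 hi.1).1,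
        goodDigit_of_not_inserted (hc.1 hi.1)] at h0
      exact (hn₀ i hc.2).ne' h0
    have h1 := (Finset.card_le_card hsub).trans (Finset.card_union_le _ _)
    rw [Finset.card_range] at h1
    have h2 : (blockCount q (fun _ : Fin 1 => 0) x n : ℝ) ≤
        ((Finset.Icc 1 n).filter (InsertedAt q)).card + n₀ := by
      rw [blockCount]
      exact_mod_cast h1
    linarith [card_insertedAt_le hq n]
  have hlim2 : Tendsto (fun n => 1 / 2 + (totalLen (level (cost q)) 1 + n₀ : ℝ) *
      (∑ i ∈ Finset.Icc 1 n, (1 : ℝ) / q i)⁻¹) atTop (𝓝 (1 / 2)) := by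
    simpa using (hsum.inv_tendsto_atTop.const_mul
      (totalLen (level (cost q)) 1 + n₀ : ℝ)).const_add (1 / 2 : ℝ)
  have hle := le_of_tendsto_of_tendsto h hlim2 (by
    filter_upwards [hsum.eventually_gt_atTop 0] with n hn
    rw [div_le_iff₀ hn, add_mul, mul_assoc, inv_mul_cancel₀ hn.ne']
    linarith [hcount n])
  norm_num at hle

/-- Raising the digit to the square root costs at most `√q`, and rounding costs a constant; relative
to `q` both vanish. The generous constants match `tendsto_sqrt_div_self`, which is then applied
along `q`. -/
theorem spreadDigit_close {n : ℕ} (h : 1 ≤ q (n + 1)) {t : ℝ}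
    (h1 : (spreadDigit q (n + 1) : ℝ) ≤ q (n + 1) * t)
    (h2 : (q (n + 1) : ℝ) * t < spreadDigit q (n + 1) + 1) :
    |t - squareFrac n| ≤ (3 * √(q (n + 1) : ℝ) + 2) / q (n + 1) := by
  have hq0 : (0 : ℝ) < q (n + 1) := by exact_mod_cast h
  have hy0 := squareFrac_nonneg n
  have hy1 := squareFrac_lt_one n
  have hs : (Nat.sqrt (q (n + 1)) : ℝ) ≤ √(q (n + 1) : ℝ) := Real.nat_sqrt_le_real_sqrt
  set m := (q (n + 1) - 1) * (n - Nat.sqrt n ^ 2) / (2 * Nat.sqrt n + 1) with hm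
  have hspread : spreadDigit q (n + 1) = max (Nat.sqrt (q (n + 1))) m := by
    rw [spreadDigit, Nat.add_sub_cancel]
  have hreal : ((q (n + 1) - 1) * (n - Nat.sqrt n ^ 2) : ℕ) / ((2 * Nat.sqrt n + 1 : ℕ) : ℝ) =
      (q (n + 1) - 1 : ℝ) * squareFrac n := by
    rw [Nat.cast_mul, Nat.cast_sub h, squareFrac, mul_div_assoc, Nat.cast_one]
  have hm1 : (m : ℝ) ≤ (q (n + 1) - 1 : ℝ) * squareFrac n := by
    rw [← hreal]; exact Nat.cast_div_le
  have hm2 : (q (n + 1) - 1 : ℝ) * squareFrac n < m + 1 := by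
    rw [← hreal, hm, ← Nat.floor_div_eq_div (K := ℝ)]; exact Nat.lt_floor_add_one _
  have hs0 : 0 ≤ √(q (n + 1) : ℝ) := Real.sqrt_nonneg _
  have hup : (spreadDigit q (n + 1) : ℝ) ≤ √(q (n + 1) : ℝ) + q (n + 1) * squareFrac n := by
    rw [hspread, Nat.cast_max]
    refine max_le ?_ ?_ <;> nlinarith
  have hlo : (m : ℝ) ≤ spreadDigit q (n + 1) := by
    rw [hspread]; exact_mod_cast le_max_right _ _
  rw [le_div_iff₀ hq0, ← abs_of_pos hq0, ← abs_mul, abs_of_pos hq0, abs_le]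
  constructor <;> nlinarith

theorem card_filter_Icc_eq_count (p : ℕ → Prop) [DecidablePred p] (n : ℕ) :
    ((Finset.Icc 1 n).filter p).card = Nat.count (fun i => p (i + 1)) n := by
  rw [Nat.count_eq_card_filter_range, Finset.card_filter, Finset.card_filter,
    Finset.range_eq_Ico, Finset.sum_Ico_add' (fun i => if p i then 1 else 0) 0 n 1]
  rfl

theorem tendsto_card_insertedAt_div (hq : IsBasic q) (hlim : Tendsto q atTop atTop) (C : ℝ) :
    Tendsto (fun n : ℕ => (((Finset.Icc 1 n).filter (InsertedAt q)).card + C : ℝ) / n)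
      atTop (𝓝 0) := by
  -- The insertions number at most half of `∑ 1 / q i` plus a constant, and the Cesàro means of `1 /
  -- q i` tend to 0.
  have hces : Tendsto (fun n : ℕ => (n : ℝ)⁻¹ * ∑ i ∈ Finset.range n, (1 : ℝ) / q (i + 1))
      atTop (𝓝 0) := by
    refine Tendsto.cesaro ?_
    exact (tendsto_one_div_atTop_nhds_zero_nat.comp hlim).comp (tendsto_add_atTop_nat 1)
  have hC := fun C : ℝ => (tendsto_one_div_atTop_nhds_zero_nat (𝕜 := ℝ)).const_mul C
  have hbound := (hces.const_mul (1 / 2)).add (hC (totalLen (level (cost q)) 1 + C))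
  have hlow := hC C
  simp only [mul_zero, add_zero] at hbound hlow
  refine tendsto_of_tendsto_of_tendsto_of_le_of_le hlow hbound (fun n => ?_) (fun n => ?_)
  · simp only
    rw [mul_one_div]
    gcongr
    linarith [Nat.cast_nonneg (α := ℝ) ((Finset.Icc 1 n).filter (InsertedAt q)).card]
  · have h := card_insertedAt_le hq n
    have hsum : ∑ i ∈ Finset.range n, (1 : ℝ) / q (i + 1) =
        ∑ i ∈ Finset.Icc 1 n, (1 : ℝ) / q i := by
      rw [Finset.range_eq_Ico, Finset.sum_Ico_add' (fun i => (1 : ℝ) / q i) 0 n 1]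
      rfl
    simp only
    rw [hsum]
    calc _ ≤ ((∑ i ∈ Finset.Icc 1 n, (1 : ℝ) / q i) / 2 +
          (totalLen (level (cost q)) 1 + C)) / n := by gcongr ?_ / _; linarith
      _ = _ := by ring

theorem isDistributionNormal_of_digits (hq : IsBasic q) (hlim : Tendsto q atTop atTop) {x : ℝ}
    (hx : ∀ n, 1 ≤ n → digit q x n = goodDigit q n) : IsDistributionNormal q x := by
  classical
  have hT0 : ∀ n, 0 ≤ T q n x := fun n => Int.fract_nonneg _
  have hT1 : ∀ n, T q n x < 1 := fun n => Int.fract_lt_one _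
  refine uniformlyDistributedMod1_of_tendsto_count hT0 hT1 fun c h0 h1 => ?_
  refine tendsto_count_lt_of_close squareFrac_nonneg squareFrac_lt_one
    (fun c h0 h1 => tendsto_count_squareFrac_lt h0 h1) (fun ε hε => ?_) h0 h1
  have hev := (((tendsto_sqrt_div_self.comp hlim).comp
    (tendsto_add_atTop_nat 1)).eventually (gt_mem_nhds hε))
  obtain ⟨n₀, hn₀⟩ := eventually_atTop.1 hev
  refine squeeze_zero (fun n => by positivity) (fun N => ?_)
    (tendsto_card_insertedAt_div hq hlim n₀)
  -- The orbit point `T q n x` is governed by the digit at `n + 1`: it is far from `squareFrac n`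
  -- only if that digit is inserted or `n` is small.
  have hcount : Nat.count (fun n => ε < |T q n x - squareFrac n|) N ≤
      Nat.count (fun n => InsertedAt q (n + 1)) N + Nat.count (fun n => n < n₀) N := by
    refine count_le_count_add_count (fun n hn => ?_) N
    by_contra! hc
    have hd := hx (n + 1) (by omega)
    rw [goodDigit_of_not_inserted hc.1, digit, Nat.add_sub_cancel] at hd
    have hnn : 0 ≤ (q (n + 1) : ℝ) * T q n x := mul_nonneg (Nat.cast_nonneg _) (hT0 n)
    have hcl := spreadDigit_close (q := q) (n := n) (t := T q n x)
      (by have := hq (n + 1) (by omega); omega)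
      (by rw [← hd]; exact Nat.floor_le hnn) (by rw [← hd]; exact Nat.lt_floor_add_one _)
    have := hn₀ n hc.2
    simp only [Function.comp_apply] at this
    linarith
  have hlt : Nat.count (fun n => n < n₀) N ≤ n₀ := by
    rw [Nat.count_eq_card_filter_range]
    refine (Finset.card_le_card (t := Finset.range n₀) fun n hn => ?_).trans
      (Finset.card_range n₀).le
    exact Finset.mem_range.2 (Finset.mem_filter.1 hn).2
  rw [card_filter_Icc_eq_count]
  gcongr
  exact_mod_cast hcount.trans (Nat.add_le_add_left hlt _)

end Construction

end CantorSeries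

/-! ### The main theorem -/

theorem mainTheorem5 (q : ℕ → ℕ)
    (hbasic : CantorSeries.IsBasic q)
    (hlim : Filter.Tendsto q Filter.atTop Filter.atTop)
    (hdiv : ∃ k : ℕ, 1 ≤ k ∧ ∃ B : Fin k → ℕ, CantorSeries.BlockDivergent q B)
    (hcomp : Computable q)
    (hL : Computable (CantorSeries.L q)) :
    ∃ x : ℝ, CantorSeries.IsComputableReal x ∧
      CantorSeries.IsRatioNormal q x ∧
      CantorSeries.IsDistributionNormal q x ∧
      ¬ CantorSeries.IsNormal q x := by
  have hsum := CantorSeries.tendsto_sum_inv hbasic hdiv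
  obtain ⟨x, hx⟩ := CantorSeries.exists_real_of_digits hbasic
    (CantorSeries.goodDigit_lt hbasic hlim) (CantorSeries.exists_goodDigit_succ_lt hlim)
  have hd : ∀ n, 1 ≤ n → CantorSeries.digit q x n = CantorSeries.goodDigit q n :=
    fun n hn => CantorSeries.digit_eq_of_bounds hx hn
  exact ⟨x,
    CantorSeries.isComputableReal_of_bounds hbasic hcomp
      (CantorSeries.computable_goodDigit hcomp hL) hx,
    CantorSeries.isRatioNormal_of_digits hlim
      (CantorSeries.tendsto_harmonicFloor hbasic hsum) hd,
    CantorSeries.isDistributionNormal_of_digits hbasic hlim hd,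
    CantorSeries.not_isNormal_of_digits hbasic hlim hsum hd⟩
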